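/- Let $\mathbb{B}^2\subset\mathbb{R}^2$ be the open unit disk, $N\in\mathbb{N}$, and let $\lambda_0\in L^\infty(\mathbb{B}^2)$ satisfy $\operatorname{ess\,inf}_{\mathbb{B}^2}\lambda_0>0$ (for instance, a positive constant). Let $\lambda\in H^1(\mathbb{B}^2)$ and $v\in H^1(\mathbb{B}^2,\mathbb{R}^N)$ with $|v|=1$ a.e., $\lambda\ge\lambda_0$ a.e. in $\mathbb{B}^2$ and $\lambda v\in H^1(\mathbb{B}^2,\mathbb{R}^N)$ (equivalently, the energy below is finite at $(\lambda,v)$). Suppose that $(\lambda,v)$ is critical for the energy $$E(\lambda,v):=\int_{\mathbb{B}^2}|\nabla\lambda|^2+\int_{\mathbb{B}^2}\lambda^2|\nabla v|^2$$ subject to $\lambda\ge\lambda_0$, that is: - for every $\varphi\in H^1_0(\mathbb{B}^2)$ such that, for all sufficiently small $\varepsilon>0$, $\lambda+\varepsilon\varphi\ge\lambda_0$ a.e. in $\mathbb{B}^2$ and $(\lambda+\varepsilon\varphi)v\in H^1(\mathbb{B}^2,\mathbb{R}^N)$, one has $$\frac{d}{d\varepsilon}\Big|_{\varepsilon=0^+}E(\lambda+\varepsilon\varphi,v)\ge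 0;$$ - for every $\psi\in C_c^\infty(\mathbb{B}^2,\mathbb{R}^N)$, $$\frac{d}{d\varepsilon}\Big|_{\varepsilon=0}E\left(\lambda,\frac{v+\varepsilon\psi}{|v+\varepsilon\psi|}\right)=0.$$ Then $\lambda\in L^\infty_{\mathrm{loc}}(\mathbb{B}^2)$; that is, $\lambda\in L^\infty(K)$ for every compact set $K\subset\mathbb{B}^2$. -/

import Mathlib

open MeasureTheory Set Filter Topology
open scoped ContDiff

noncomputable section

/-- The Euclidean plane. -/
abbrev Plane : Type := EuclideanSpace ℝ (Fin 2)

/-- The open unit disk `𝔹²` of the plane. -/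
def unitDisk : Set Plane := Metric.ball 0 1

/-- The `i`-th standard basis vector of the plane. -/
def stdVec (i : Fin 2) : Plane := EuclideanSpace.single i (1 : ℝ)

/-- `ψ ∈ C_c^∞(Ω, F)`. -/
structure IsTestFunction {F : Type*} [NormedAddCommGroup F] [NormedSpace ℝ F]
    (Ω : Set Plane) (ψ : Plane → F) : Prop where
  smooth : ContDiff ℝ ∞ ψ
  compact : HasCompactSupport ψ
  support : tsupport ψ ⊆ Ω

/-- The locally integrable function `g` is the weak partial derivative `∂ᵢ f` of the locally
integrable function `f` in the open set `Ω`. -/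
structure HasWeakPartial {F : Type*} [NormedAddCommGroup F] [NormedSpace ℝ F]
    (Ω : Set Plane) (i : Fin 2) (f g : Plane → F) : Prop where
  locInt : LocallyIntegrableOn f Ω volume
  locInt_deriv : LocallyIntegrableOn g Ω volume
  integral_eq : ∀ ψ : Plane → ℝ, IsTestFunction Ω ψ →
    ∫ x in Ω, (fderiv ℝ ψ x (stdVec i)) • f x = - ∫ x in Ω, ψ x • g x

/-- Weak partial derivatives are unique almost everywhere. -/
theorem HasWeakPartial.ae_eq {F : Type*} [NormedAddCommGroup F] [NormedSpace ℝ F]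
    [CompleteSpace F] {Ω : Set Plane} (hΩ : IsOpen Ω) {i : Fin 2} {f g₁ g₂ : Plane → F}
    (h₁ : HasWeakPartial Ω i f g₁) (h₂ : HasWeakPartial Ω i f g₂) :
    g₁ =ᵐ[volume.restrict Ω] g₂ := by
  have key : ∀ᵐ x ∂(volume : Measure Plane), x ∈ Ω → (g₁ - g₂) x = 0 := by
    refine hΩ.ae_eq_zero_of_integral_contDiff_smul_eq_zero
      (h₁.locInt_deriv.sub h₂.locInt_deriv) ?_
    intro ψ hs hc ht
    have hint : ∀ g : Plane → F, LocallyIntegrableOn g Ω volume →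
        Integrable (fun x => ψ x • g x) volume := by
      intro g hg
      have hgt : IntegrableOn g (tsupport ψ) volume := hg.integrableOn_compact_subset ht hc
      have h0 : IntegrableOn (fun x => ψ x • g x) (tsupport ψ) volume :=
        hgt.continuousOn_smul hs.continuous.continuousOn hc
      refine (integrableOn_iff_integrable_of_support_subset ?_).1 h0
      exact (Function.support_smul_subset_left ψ g).trans (subset_tsupport ψ)
    have hset : ∀ g : Plane → F, ∫ x in Ω, ψ x • g x = ∫ x, ψ x • g x := by
      intro g
      refine setIntegral_eq_integral_of_forall_compl_eq_zero ?_
      intro x hx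
      have : ψ x = 0 := by
        by_contra hne
        exact hx (ht (subset_tsupport ψ hne))
      simp [this]
    have e := (h₁.integral_eq ψ ⟨hs, hc, ht⟩).symm.trans (h₂.integral_eq ψ ⟨hs, hc, ht⟩)
    rw [hset, hset] at e
    simp only [Pi.sub_apply, smul_sub]
    rw [integral_sub (hint _ h₁.locInt_deriv) (hint _ h₂.locInt_deriv), neg_injective e, sub_self]
  rw [Filter.EventuallyEq, ae_restrict_iff' hΩ.measurableSet]
  filter_upwards [key] with x hx hxΩ
  exact sub_eq_zero.1 (hx hxΩ)

open Classical in
/-- The weak partial derivative `∂ᵢ f` in `Ω` (zero if there is none). -/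
def weakPartial {F : Type*} [NormedAddCommGroup F] [NormedSpace ℝ F]
    (Ω : Set Plane) (i : Fin 2) (f : Plane → F) : Plane → F :=
  if h : ∃ g, HasWeakPartial Ω i f g then h.choose else 0

/-- `weakPartial Ω i f` is the weak partial derivative as soon as there is one. -/
theorem HasWeakPartial.ae_eq_weakPartial {F : Type*} [NormedAddCommGroup F] [NormedSpace ℝ F]
    [CompleteSpace F] {Ω : Set Plane} (hΩ : IsOpen Ω) {i : Fin 2} {f g : Plane → F}
    (h : HasWeakPartial Ω i f g) : weakPartial Ω i f =ᵐ[volume.restrict Ω] g := by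
  have hex : ∃ g, HasWeakPartial Ω i f g := ⟨g, h⟩
  rw [weakPartial, dif_pos hex]
  exact hex.choose_spec.ae_eq hΩ h

/-- `f ∈ H¹(Ω, F)`: `f` and its weak first order partial derivatives are in `L²(Ω, F)`. -/
structure MemH1 {F : Type*} [NormedAddCommGroup F] [NormedSpace ℝ F]
    (Ω : Set Plane) (f : Plane → F) : Prop where
  memLp : MemLp f 2 (volume.restrict Ω)
  weakDeriv : ∀ i, ∃ g, HasWeakPartial Ω i f g ∧ MemLp g 2 (volume.restrict Ω)

/-- `f ∈ H¹₀(Ω, F)`: `f` is in the closure of `C_c^∞(Ω, F)` in `H¹(Ω, F)`. -/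
structure MemH10 {F : Type*} [NormedAddCommGroup F] [NormedSpace ℝ F]
    (Ω : Set Plane) (f : Plane → F) : Prop where
  memH1 : MemH1 Ω f
  approx : ∀ δ : ℝ, 0 < δ → ∃ ψ : Plane → F, IsTestFunction Ω ψ ∧
    eLpNorm (fun x => f x - ψ x) 2 (volume.restrict Ω) ≤ ENNReal.ofReal δ ∧
    ∀ i, eLpNorm (fun x => weakPartial Ω i f x - fderiv ℝ ψ x (stdVec i)) 2
      (volume.restrict Ω) ≤ ENNReal.ofReal δ

/-- `|∇f|²`, the sum of the squares of all the first order weak partial derivatives of all the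
components of `f`, in `Ω`. -/
def gradSq {F : Type*} [NormedAddCommGroup F] [NormedSpace ℝ F]
    (Ω : Set Plane) (f : Plane → F) (x : Plane) : ℝ :=
  ∑ i, ‖weakPartial Ω i f x‖ ^ 2

/-- The energy `E(λ, v) = ∫ |∇λ|² + ∫ λ² |∇v|²` over the unit disk. It is used only where it is
finite: for `λ ∈ H¹(𝔹²)` and `v ∈ H¹(𝔹², 𝕊ᴺ⁻¹)` this is equivalent to `λ v ∈ H¹(𝔹², ℝᴺ)`. -/
def energy {N : ℕ} (lam : Plane → ℝ) (v : Plane → EuclideanSpace ℝ (Fin N)) : ℝ :=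
  (∫ x in unitDisk, gradSq unitDisk lam x) +
    ∫ x in unitDisk, lam x ^ 2 * gradSq unitDisk v x

/-- `(λ, v) ∈ H¹(𝔹²) × H¹(𝔹², 𝕊ᴺ⁻¹)`, of finite energy (that is, `λ v ∈ H¹(𝔹², ℝᴺ)`), is a
critical pair of the energy `E` subject to the constraint `λ ≥ λ₀`. -/
structure IsCriticalPair {N : ℕ} (lam₀ lam : Plane → ℝ)
    (v : Plane → EuclideanSpace ℝ (Fin N)) : Prop where
  memH1_lam : MemH1 unitDisk lam
  memH1_v : MemH1 unitDisk v
  norm_v : ∀ᵐ x ∂(volume.restrict unitDisk), ‖v x‖ = 1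
  memH1_mul : MemH1 unitDisk (fun x => lam x • v x)
  obstacle : ∀ᵐ x ∂(volume.restrict unitDisk), lam₀ x ≤ lam x
  /-- One-sided criticality in `λ`: whenever `φ ∈ H¹₀(𝔹²)` and, for all small `ε > 0`, the
  competitor `λ + ε φ` satisfies the constraint and `(λ + ε φ) v ∈ H¹`, the right derivative of
  `ε ↦ E(λ + ε φ, v)` at `0` is nonnegative. -/
  var_lam : ∀ φ : Plane → ℝ, MemH10 unitDisk φ →
    (∃ ε₀ : ℝ, 0 < ε₀ ∧ ∀ ε : ℝ, 0 < ε → ε < ε₀ →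
      (∀ᵐ x ∂(volume.restrict unitDisk), lam₀ x ≤ lam x + ε * φ x) ∧
      MemH1 unitDisk (fun x => (lam x + ε * φ x) • v x)) →
    ∃ d : ℝ, HasDerivWithinAt (fun ε : ℝ => energy (fun x => lam x + ε * φ x) v) d (Ici 0) 0 ∧
      0 ≤ d
  /-- Criticality in `v`. -/
  var_v : ∀ ψ : Plane → EuclideanSpace ℝ (Fin N), IsTestFunction unitDisk ψ →
    HasDerivAt (fun ε : ℝ => energy lam (fun x => ‖v x + ε • ψ x‖⁻¹ • (v x + ε • ψ x))) 0 0

end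

/-! Let `M` be the essential supremum of `|lam₀|`. Above the level `M` the obstacle is not felt, so
`λ` may be lowered there. Take a smooth nondecreasing `T` with values in `[0, 1]` that vanishes on
`(-∞, M]`, and a test function `η ≥ 0`. The variation `φ = -η T(λ)` is admissible for small `ε`: it
moves `λ` only where `λ > M`, and by at most `λ - M`. Since `λ + εφ ≥ lam₀ ≥ 0`, lowering `λ` can
only decrease `∫ λ² |∇v|²`, so one-sided criticality leaves `0 ≤ ∫ ∇λ · ∇φ`. Expanding `∇φ` and
dropping the term `-η T'(λ) |∇λ|² ≤ 0` gives, for a primitive `G` of `T`, `0 ≤ -∫ ∇η · ∇(G(λ)) = ∫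
Δη G(λ)`: the function `G(λ)` is weakly subharmonic
(`IsCriticalPair.integral_laplacian_mul_nonneg`).

A weakly subharmonic integrable function is locally bounded above (`exists_ae_le_of_subharmonic`).
Testing with the difference of two radial potentials yields monotonicity of weighted averages in the
radius: small-scale averages, which tend to the function at Lebesgue points, are bounded by an
average at a fixed scale, hence by the `L¹` norm. As `G(t) ≥ t - M - 1`, this bounds `λ` from above,
while `λ ≥ lam₀ ≥ 0` bounds it from below.

The rest is calculus of weak derivatives: the product rule, the chain rule and membership in `H¹₀`,
all obtained by cutoff and mollification. -/

/-! ### Mollification in `L²` -/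

theorem eLpNorm_two_sq {α F : Type*} [MeasurableSpace α] {μ : Measure α} [NormedAddCommGroup F]
    (f : α → F) : eLpNorm f 2 μ ^ 2 = ∫⁻ x, ‖f x‖ₑ ^ 2 ∂μ := by
  have := eLpNorm_nnreal_pow_eq_lintegral (f := f) (μ := μ) (p := 2) (by norm_num)
  simpa using this

/-- Translations act continuously on `L²`. -/
theorem tendsto_eLpNorm_translate_sub {f : Plane → ℝ} (hf : MemLp f 2 volume) :
    Tendsto (fun t : Plane => eLpNorm (fun x => f (x - t) - f x) 2 volume) (𝓝 0) (𝓝 0) := by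
  have : Fact ((2 : ENNReal) ≠ ⊤) := ⟨by simp⟩
  set F := hf.toLp f
  -- `DomAddAct.mk c` acts by `f ↦ f (c + ·)`, hence the sign of `t`.
  have hc : Continuous (fun t : Plane => (DomAddAct.mk (-t) +ᵥ F : Lp ℝ 2 volume)) := by
    have h1 : Continuous (fun t : Plane => DomAddAct.mk (-t)) :=
      (DomAddAct.continuous_mk).comp continuous_neg
    exact h1.vadd continuous_const
  have h2 := hc.tendsto 0
  have h3 : (DomAddAct.mk (-(0 : Plane)) +ᵥ F : Lp ℝ 2 volume) = F := by simp
  rw [h3, tendsto_iff_edist_tendsto_0] at h2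
  refine h2.congr fun t => ?_
  have h4 : (DomAddAct.mk (-t) +ᵥ F : Lp ℝ 2 volume) =
      (hf.comp_measurePreserving (measurePreserving_vadd (-t) volume)).toLp _ :=
    DomAddAct.mk_vadd_toLp (-t) hf
  rw [h4, Lp.edist_toLp_toLp]
  refine eLpNorm_congr_ae (Eventually.of_forall fun x => ?_)
  simp [sub_eq_neg_add]

/-- Jensen's inequality for the square, the normed bump being a probability density. -/
theorem enorm_integral_normed_smul_sq_le (ρ : ContDiffBump (0 : Plane)) {g : Plane → ℝ}
    (hg : AEStronglyMeasurable g volume) :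
    ‖∫ t, ρ.normed volume t • g t‖ₑ ^ 2 ≤
      ∫⁻ t, ENNReal.ofReal (ρ.normed volume t) * ‖g t‖ₑ ^ 2 := by
  set k : Plane → NNReal := fun t => Real.toNNReal (ρ.normed volume t)
  have hkm : Measurable k := (ρ.continuous_normed).measurable.real_toNNReal
  set ν : Measure Plane := volume.withDensity (fun t => (k t : ENNReal))
  have hk : ∀ t, ((k t : NNReal) : ℝ) = ρ.normed volume t := fun t =>
    Real.coe_toNNReal _ (ρ.nonneg_normed t)
  have hν : IsProbabilityMeasure ν := by
    refine ⟨?_⟩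
    have : ν univ = ∫⁻ t, ENNReal.ofReal (ρ.normed volume t) := by
      simp [ν, withDensity_apply, k, ENNReal.ofReal]
    rw [this, ← ofReal_integral_eq_lintegral_ofReal ρ.integrable_normed
      (Eventually.of_forall ρ.nonneg_normed), ρ.integral_normed]
    simp
  have h1 : ∫ t, ρ.normed volume t • g t = ∫ t, g t ∂ν := by
    rw [integral_withDensity_eq_integral_smul hkm]
    refine integral_congr_ae (Eventually.of_forall fun t => ?_)
    simp [NNReal.smul_def, hk]
  have hgν : AEStronglyMeasurable g ν := hg.mono_ac (withDensity_absolutelyContinuous _ _)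
  have h2 : ‖∫ t, g t ∂ν‖ₑ ≤ eLpNorm g 2 ν := by
    refine (enorm_integral_le_lintegral_enorm _).trans ?_
    rw [← eLpNorm_one_eq_lintegral_enorm]
    exact eLpNorm_le_eLpNorm_of_exponent_le (by norm_num) hgν
  rw [h1]
  refine (pow_le_pow_left' h2 2).trans ?_
  rw [eLpNorm_two_sq, lintegral_withDensity_eq_lintegral_mul₀ hkm.coe_nnreal_ennreal.aemeasurable
    (hg.enorm.pow_const 2)]
  rfl

/-- The mollification of `f` by a bump function. -/
noncomputable def mollify (ρ : ContDiffBump (0 : Plane)) (f : Plane → ℝ) (x : Plane) : ℝ :=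
  ∫ t, ρ.normed volume t • f (x - t)

/-- The error `mollify ρ f - f` is an average of the differences `f (· - t) - f` over the support of
the bump; Jensen and Tonelli transfer a uniform bound on these to the average. -/
theorem eLpNorm_mollify_sub_le (ρ : ContDiffBump (0 : Plane)) {f : Plane → ℝ}
    (hf : MemLp f 2 volume) {ε : ENNReal}
    (hε : ∀ t ∈ Metric.ball (0 : Plane) ρ.rOut,
      eLpNorm (fun x => f (x - t) - f x) 2 volume ≤ ε) :
    eLpNorm (fun x => mollify ρ f x - f x) 2 volume ≤ ε := by
  have hloc : LocallyIntegrable f volume := hf.locallyIntegrable (by norm_num)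
  have hmeas : AEStronglyMeasurable (fun p : Plane × Plane => f (p.1 - p.2) - f p.1)
      (volume.prod volume) :=
    (hf.1.comp_quasiMeasurePreserving (quasiMeasurePreserving_sub _ _)).sub hf.1.comp_fst
  have hint : ∀ x, Integrable (fun t => ρ.normed volume t • f (x - t)) volume := fun x =>
    (ρ.hasCompactSupport_normed.convolutionExists_left (ContinuousLinearMap.lsmul ℝ ℝ)
      ρ.continuous_normed hloc x)
  have h1 : ∀ x, mollify ρ f x - f x = ∫ t, ρ.normed volume t • (f (x - t) - f x) := by
    intro x
    simp only [smul_sub]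
    rw [integral_sub (hint x) (ρ.integrable_normed.smul_const _), integral_smul_const,
      ρ.integral_normed, one_smul, mollify]
  have h2 : ∀ x, AEStronglyMeasurable (fun t => f (x - t) - f x) volume := fun x =>
    (hf.1.comp_quasiMeasurePreserving
      (quasiMeasurePreserving_sub_left volume x)).sub aestronglyMeasurable_const
  have key : ∫⁻ x, ‖mollify ρ f x - f x‖ₑ ^ 2 ≤ ε ^ 2 := by
    calc ∫⁻ x, ‖mollify ρ f x - f x‖ₑ ^ 2
        ≤ ∫⁻ x, ∫⁻ t, ENNReal.ofReal (ρ.normed volume t) * ‖f (x - t) - f x‖ₑ ^ 2 := by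
          refine lintegral_mono fun x => ?_
          rw [h1]
          exact enorm_integral_normed_smul_sq_le ρ (h2 x)
      _ = ∫⁻ t, ∫⁻ x, ENNReal.ofReal (ρ.normed volume t) * ‖f (x - t) - f x‖ₑ ^ 2 := by
          refine lintegral_lintegral_swap ?_
          refine AEMeasurable.mul ?_ (hmeas.enorm.pow_const 2)
          exact (ρ.continuous_normed.measurable.comp measurable_snd).ennreal_ofReal.aemeasurable
      _ = ∫⁻ t, ENNReal.ofReal (ρ.normed volume t) * ∫⁻ x, ‖f (x - t) - f x‖ₑ ^ 2 := by
          refine lintegral_congr fun t => ?_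
          rw [lintegral_const_mul' _ _ ENNReal.ofReal_ne_top]
      _ ≤ ∫⁻ t, ENNReal.ofReal (ρ.normed volume t) * ε ^ 2 := by
          refine lintegral_mono fun t => ?_
          by_cases ht : t ∈ Metric.ball (0 : Plane) ρ.rOut
          · gcongr
            have h3 := pow_le_pow_left' (hε t ht) 2
            rwa [eLpNorm_two_sq] at h3
          · have : ρ.normed volume t = 0 := by
              rw [← ρ.support_normed_eq (μ := volume)] at ht
              simpa using ht
            simp [this]
      _ = ε ^ 2 := by
          rw [lintegral_mul_const _ ρ.continuous_normed.measurable.ennreal_ofReal,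
            ← ofReal_integral_eq_lintegral_ofReal ρ.integrable_normed
            (Eventually.of_forall ρ.nonneg_normed), ρ.integral_normed]
          simp
  rw [← eLpNorm_two_sq] at key
  exact (ENNReal.pow_le_pow_left_iff two_ne_zero).1 key

/-! ### Test functions, cutoffs and weak derivatives -/

namespace IsTestFunction

variable {F : Type*} [NormedAddCommGroup F] [NormedSpace ℝ F] {Ω Ω' : Set Plane}

theorem mono {ψ : Plane → F} (h : IsTestFunction Ω ψ) (hΩ : Ω ⊆ Ω') : IsTestFunction Ω' ψ :=
  ⟨h.smooth, h.compact, h.support.trans hΩ⟩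

theorem eq_zero {ψ : Plane → F} (h : IsTestFunction Ω ψ) {x : Plane} (hx : x ∉ Ω) : ψ x = 0 :=
  image_eq_zero_of_notMem_tsupport fun h' => hx (h.support h')

theorem fderiv_stdVec {ψ : Plane → F} (h : IsTestFunction Ω ψ) (i : Fin 2) :
    IsTestFunction Ω (fun x => fderiv ℝ ψ x (stdVec i)) where
  smooth := by
    have : ContDiff ℝ ∞ (fderiv ℝ ψ) := h.smooth.fderiv_right (by simp)
    exact this.clm_apply contDiff_const
  compact := h.compact.fderiv_apply ℝ _
  support := (tsupport_fderiv_apply_subset ℝ _).trans h.support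

theorem mul_contDiff {ψ f : Plane → ℝ} (h : IsTestFunction Ω ψ) (hf : ContDiff ℝ ∞ f) :
    IsTestFunction Ω (fun x => ψ x * f x) where
  smooth := h.smooth.mul hf
  compact := h.compact.mul_right
  support := (tsupport_mul_subset_left (f := ψ) (g := f)).trans h.support

theorem memLp {ψ : Plane → F} (h : IsTestFunction Ω ψ) (p : ENNReal) : MemLp ψ p volume :=
  h.smooth.continuous.memLp_of_hasCompactSupport h.compact

theorem exists_norm_le {ψ : Plane → F} (h : IsTestFunction Ω ψ) : ∃ C, ∀ x, ‖ψ x‖ ≤ C :=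
  h.smooth.continuous.bounded_above_of_compact_support h.compact

theorem setIntegral_smul {ψ : Plane → ℝ} (h : IsTestFunction Ω ψ) (f : Plane → F) :
    ∫ x in Ω, ψ x • f x = ∫ x, ψ x • f x :=
  setIntegral_eq_integral_of_forall_compl_eq_zero fun x hx => by simp [h.eq_zero hx]

theorem integrable_smul {ψ : Plane → ℝ} (h : IsTestFunction Ω ψ) {f : Plane → F}
    (hf : LocallyIntegrableOn f Ω volume) : Integrable (fun x => ψ x • f x) volume := by
  have h0 : IntegrableOn (fun x => ψ x • f x) (tsupport ψ) volume :=
    (hf.integrableOn_compact_subset h.support h.compact).continuousOn_smul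
      h.smooth.continuous.continuousOn h.compact
  exact (integrableOn_iff_integrable_of_support_subset
    ((Function.support_smul_subset_left ψ f).trans (subset_tsupport ψ))).1 h0

end IsTestFunction

/-- The value `1` is taken on a neighbourhood of `K`, so that the derivative of the cutoff vanishes
on `K` too. -/
theorem exists_isTestFunction_eq_one {Ω K : Set Plane} (hΩ : IsOpen Ω) (hK : IsCompact K)
    (hKΩ : K ⊆ Ω) : ∃ χ : Plane → ℝ, IsTestFunction Ω χ ∧ ∀ᶠ x in 𝓝ˢ K, χ x = 1 := by
  obtain ⟨L, hL, hKL, hLΩ⟩ := exists_compact_between hK hΩ hKΩ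
  obtain ⟨f, hf1, hf0, -⟩ := exists_contMDiffMap_one_nhds_of_subset_interior
    (modelWithCornersSelf ℝ Plane) (n := (⊤ : ℕ∞)) hK.isClosed hKL
  have hs : Function.support f ⊆ L := fun x hx => by
    by_contra h
    exact hx (hf0 x h)
  exact ⟨f, ⟨f.contMDiff.contDiff, HasCompactSupport.of_support_subset_isCompact hL hs,
    (closure_minimal hs hL.isClosed).trans hLΩ⟩, hf1⟩

namespace HasWeakPartial

variable {F : Type*} [NormedAddCommGroup F] [NormedSpace ℝ F] {Ω : Set Plane} {i : Fin 2}

theorem integral_smul_eq {f g : Plane → F} (h : HasWeakPartial Ω i f g) {ψ : Plane → ℝ}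
    (hψ : IsTestFunction Ω ψ) :
    ∫ x, fderiv ℝ ψ x (stdVec i) • f x = -∫ x, ψ x • g x := by
  rw [← (hψ.fderiv_stdVec i).setIntegral_smul f, ← hψ.setIntegral_smul g]
  exact h.integral_eq ψ hψ

theorem of_integral_smul_eq {f g : Plane → F} (hf : LocallyIntegrableOn f Ω volume)
    (hg : LocallyIntegrableOn g Ω volume) (h : ∀ ψ : Plane → ℝ, IsTestFunction Ω ψ →
      ∫ x, fderiv ℝ ψ x (stdVec i) • f x = -∫ x, ψ x • g x) : HasWeakPartial Ω i f g :=
  ⟨hf, hg, fun ψ hψ => by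
    rw [(hψ.fderiv_stdVec i).setIntegral_smul f, hψ.setIntegral_smul g]; exact h ψ hψ⟩

/-- Multiplication by a test function extends a weakly differentiable function to the plane. -/
theorem cutoff {f g χ : Plane → ℝ} (h : HasWeakPartial Ω i f g) (hχ : IsTestFunction Ω χ) :
    HasWeakPartial univ i (fun x => χ x * f x)
      (fun x => fderiv ℝ χ x (stdVec i) * f x + χ x * g x) := by
  have i1 : Integrable (fun x => χ x * f x) volume := hχ.integrable_smul h.locInt
  have i2 : Integrable (fun x => χ x * g x) volume := hχ.integrable_smul h.locInt_deriv
  have i3 : Integrable (fun x => fderiv ℝ χ x (stdVec i) * f x) volume :=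
    (hχ.fderiv_stdVec i).integrable_smul h.locInt
  refine of_integral_smul_eq (i1.locallyIntegrable.locallyIntegrableOn _)
    ((i3.add i2).locallyIntegrable.locallyIntegrableOn _) fun ψ hψ => ?_
  -- The weak derivative of `f` is tested with `χ ψ`, which is supported in `Ω` even though `ψ` need
  -- not be.
  have ht : IsTestFunction Ω (fun x => χ x * ψ x) := hχ.mul_contDiff hψ.smooth
  have key := h.integral_smul_eq ht
  have hd : ∀ x, fderiv ℝ (fun x => χ x * ψ x) x (stdVec i) =
      χ x * fderiv ℝ ψ x (stdVec i) + ψ x * fderiv ℝ χ x (stdVec i) := fun x => by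
    rw [fderiv_fun_mul (hχ.smooth.differentiable (by simp) x)
      (hψ.smooth.differentiable (by simp) x)]
    simp
  simp only [smul_eq_mul, hd] at key ⊢
  have j1 : Integrable (fun x => fderiv ℝ ψ x (stdVec i) * (χ x * f x)) volume :=
    (hψ.fderiv_stdVec i).integrable_smul (i1.locallyIntegrable.locallyIntegrableOn _)
  have j2 : Integrable (fun x => ψ x * (χ x * g x)) volume :=
    hψ.integrable_smul (i2.locallyIntegrable.locallyIntegrableOn _)
  have j3 : Integrable (fun x => ψ x * (fderiv ℝ χ x (stdVec i) * f x)) volume :=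
    hψ.integrable_smul (i3.locallyIntegrable.locallyIntegrableOn _)
  have e1 : ∫ x, (χ x * fderiv ℝ ψ x (stdVec i) + ψ x * fderiv ℝ χ x (stdVec i)) * f x =
      (∫ x, fderiv ℝ ψ x (stdVec i) * (χ x * f x)) +
        ∫ x, ψ x * (fderiv ℝ χ x (stdVec i) * f x) := by
    rw [← integral_add j1 j3]
    congr 1; ext x; ring
  have e2 : ∫ x, ψ x * (fderiv ℝ χ x (stdVec i) * f x + χ x * g x) =
      (∫ x, ψ x * (fderiv ℝ χ x (stdVec i) * f x)) + ∫ x, ψ x * (χ x * g x) := by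
    rw [← integral_add j3 j2]
    congr 1; ext x; ring
  have e3 : ∫ x, χ x * ψ x * g x = ∫ x, ψ x * (χ x * g x) := by
    congr 1; ext x; ring
  rw [e1, e3] at key
  rw [e2]
  linarith

end HasWeakPartial

/-! ### Density of test functions in `H¹` -/

section Mollify

variable (ρ : ContDiffBump (0 : Plane))

theorem mollify_eq_convolution (f : Plane → ℝ) :
    mollify ρ f = convolution f (ρ.normed volume) (ContinuousLinearMap.mul ℝ ℝ) volume := by
  rw [← convolution_flip]
  ext x
  simp [mollify, convolution]

theorem contDiff_mollify {f : Plane → ℝ} (hf : LocallyIntegrable f volume) :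
    ContDiff ℝ ∞ (mollify ρ f) := by
  rw [mollify_eq_convolution]
  exact ρ.hasCompactSupport_normed.contDiff_convolution_right _ hf ρ.contDiff_normed

/-- The derivative falls on the kernel. For fixed `x`, the function `t ↦ ρ (x - t)` is a test
function, and the sign from its inner derivative cancels the sign in the definition of the weak
derivative. -/
theorem fderiv_mollify {f g : Plane → ℝ} {i : Fin 2} (h : HasWeakPartial univ i f g) (x : Plane) :
    fderiv ℝ (mollify ρ f) x (stdVec i) = mollify ρ g x := by
  have hf : LocallyIntegrable f volume := locallyIntegrableOn_univ.1 h.locInt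
  have hρ : ContDiff ℝ ∞ (ρ.normed volume) := ρ.contDiff_normed
  have hρ1 : ContDiff ℝ 1 (ρ.normed volume) := hρ.of_le (by simp)
  have hψ : IsTestFunction univ (fun t => ρ.normed volume (x - t)) :=
    ⟨hρ.comp (contDiff_const.sub contDiff_id),
      ρ.hasCompactSupport_normed.comp_homeomorph (Homeomorph.subLeft x), subset_univ _⟩
  have hd : ∀ t, fderiv ℝ (fun t => ρ.normed volume (x - t)) t (stdVec i) =
      - fderiv ℝ (ρ.normed volume) (x - t) (stdVec i) := fun t => by
    have h1 : HasFDerivAt (fun t => ρ.normed volume (x - t))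
        ((fderiv ℝ (ρ.normed volume) (x - t)).comp (-ContinuousLinearMap.id ℝ Plane)) t :=
      ((hρ1.differentiable (by simp) (x - t)).hasFDerivAt).comp t
        ((hasFDerivAt_id t).const_sub x)
    rw [h1.fderiv]
    simp
  have key := h.integral_smul_eq hψ
  simp only [hd, smul_eq_mul, neg_mul, integral_neg, neg_inj] at key
  rw [mollify_eq_convolution, mollify_eq_convolution,
    (ρ.hasCompactSupport_normed.hasFDerivAt_convolution_right _ hf hρ1 x).fderiv,
    convolution_precompR_apply _ hf (ρ.hasCompactSupport_normed.fderiv ℝ)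
      (hρ1.continuous_fderiv one_ne_zero)]
  simp only [convolution, ContinuousLinearMap.mul_apply']
  simp only [mul_comm (f _), mul_comm (g _)]
  exact key

theorem tsupport_mollify_subset {f : Plane → ℝ} {K : Set Plane} (hf : ∀ x ∉ K, f x = 0) :
    tsupport (mollify ρ f) ⊆ Metric.cthickening ρ.rOut K := by
  refine closure_minimal (fun x hx => ?_) Metric.isClosed_cthickening
  by_contra hxK
  refine hx (integral_eq_zero_of_ae (Eventually.of_forall fun t => ?_))
  by_cases ht : t ∈ Metric.ball (0 : Plane) ρ.rOut
  · have : f (x - t) = 0 := by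
      refine hf _ fun hmem => hxK ?_
      refine Metric.mem_cthickening_of_dist_le x (x - t) _ K hmem ?_
      rw [dist_eq_norm]
      simpa using (mem_ball_zero_iff.1 ht).le
    simp [this]
  · rw [← ρ.support_normed_eq (μ := volume)] at ht
    have : ρ.normed volume t = 0 := by simpa using ht
    simp [this]

end Mollify

/-- A function of the plane with weak gradient in `L²` that vanishes outside a compact subset of
`Ω` is the limit in `H¹` of test functions in `Ω`. -/
theorem exists_isTestFunction_tendsto {Ω K : Set Plane} (hΩ : IsOpen Ω) (hK : IsCompact K)
    (hKΩ : K ⊆ Ω) {f : Plane → ℝ} {g : Fin 2 → Plane → ℝ} (hfK : ∀ x ∉ K, f x = 0)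
    (hf : MemLp f 2 volume) (hg : ∀ i, MemLp (g i) 2 volume)
    (h : ∀ i, HasWeakPartial univ i f (g i)) :
    ∃ k : ℕ → Plane → ℝ, (∀ n, IsTestFunction Ω (k n)) ∧
      Tendsto (fun n => eLpNorm (fun x => k n x - f x) 2 volume) atTop (𝓝 0) ∧
      ∀ i, Tendsto (fun n => eLpNorm (fun x => fderiv ℝ (k n) x (stdVec i) - g i x) 2 volume)
        atTop (𝓝 0) := by
  obtain ⟨δ₀, hδ₀, hsub⟩ := hK.exists_cthickening_subset_open hΩ hKΩ
  -- The outer radii tend to `0` and never exceed `δ₀`, which keeps the supports of the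
  -- mollifications inside `Ω`.
  set ρ : ℕ → ContDiffBump (0 : Plane) := fun n =>
    ⟨δ₀ / 2 / (n + 1), δ₀ / (n + 1), by positivity, by gcongr; linarith⟩
  have hrOut : ∀ n, (ρ n).rOut = δ₀ / (n + 1) := fun n => rfl
  have hle : ∀ n, (ρ n).rOut ≤ δ₀ := fun n => by
    rw [hrOut]; exact div_le_self hδ₀.le (by linarith [Nat.cast_nonneg (α := ℝ) n])
  have hlim : Tendsto (fun n => (ρ n).rOut) atTop (𝓝 0) :=
    tendsto_const_nhds.div_atTop (tendsto_natCast_atTop_atTop.atTop_add tendsto_const_nhds)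
  have hconv : ∀ u : Plane → ℝ, MemLp u 2 volume →
      Tendsto (fun n => eLpNorm (fun x => mollify (ρ n) u x - u x) 2 volume) atTop (𝓝 0) := by
    intro u hu
    rw [ENNReal.tendsto_nhds_zero]
    intro ε hε
    have h1 := (ENNReal.tendsto_nhds_zero.1 (tendsto_eLpNorm_translate_sub hu)) ε hε
    obtain ⟨r, hr, hr'⟩ := Metric.eventually_nhds_iff_ball.1 h1
    filter_upwards [hlim.eventually (gt_mem_nhds hr)] with n hn
    exact eLpNorm_mollify_sub_le (ρ n) hu fun t ht => hr' t (Metric.ball_subset_ball hn.le ht)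
  refine ⟨fun n => mollify (ρ n) f, fun n => ?_, hconv f hf, fun i => ?_⟩
  · have hs := (tsupport_mollify_subset (ρ n) hfK).trans
      (Metric.cthickening_mono (hle n) K)
    exact ⟨contDiff_mollify _ (hf.locallyIntegrable (by norm_num)),
      HasCompactSupport.of_support_subset_isCompact (hK.cthickening)
        ((subset_tsupport _).trans hs), hs.trans hsub⟩
  · simpa only [fderiv_mollify _ (h i)] using hconv (g i) (hg i)

/-! ### Product and chain rules for weak derivatives -/

section WeakCalculus

variable {F : Type*} [NormedAddCommGroup F] [NormedSpace ℝ F] {Ω : Set Plane}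

theorem IsTestFunction.memLp_smul {χ : Plane → ℝ} (hχ : IsTestFunction Ω χ) (hΩ : IsOpen Ω)
    {p : ENNReal} {f : Plane → F} (hf : MemLp f p (volume.restrict Ω)) :
    MemLp (fun x => χ x • f x) p volume := by
  have h1 : MemLp (Ω.indicator f) p volume := (memLp_indicator_iff_restrict hΩ.measurableSet).2 hf
  have h2 : MemLp (χ • Ω.indicator f) p volume := h1.smul (hχ.memLp ⊤)
  refine h2.ae_eq (Eventually.of_forall fun x => ?_)
  by_cases hx : x ∈ Ω
  · simp [hx]
  · simp [hχ.eq_zero hx]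

omit [NormedSpace ℝ F] in
theorem MemLp.locallyIntegrableOn {f : Plane → F} (hf : MemLp f 2 (volume.restrict Ω)) :
    LocallyIntegrableOn f Ω volume := by
  intro x hx
  have h1 : MemLp f 2 (volume.restrict (Metric.ball x 1 ∩ Ω)) :=
    hf.mono_measure (Measure.restrict_mono inter_subset_right le_rfl)
  have : IsFiniteMeasure (volume.restrict (Metric.ball x 1 ∩ Ω)) :=
    ⟨by simpa using (measure_mono inter_subset_left).trans_lt measure_ball_lt_top⟩
  exact ⟨_, inter_mem (mem_nhdsWithin_of_mem_nhds (Metric.ball_mem_nhds x one_pos))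
    self_mem_nhdsWithin, h1.integrable (by norm_num)⟩

theorem tendsto_integral_smul_of_tendsto_eLpNorm {μ : Measure Plane} {k : ℕ → Plane → ℝ}
    {f : Plane → ℝ} {u : ℕ → Plane → F} {w : Plane → F} (hk : ∀ n, MemLp (k n) 2 μ)
    (hf : MemLp f 2 μ) (hu : ∀ n, MemLp (u n) 2 μ) (hw : MemLp w 2 μ)
    (h : Tendsto (fun n => eLpNorm (fun x => k n x - f x) 2 μ) atTop (𝓝 0))
    (h' : Tendsto (fun n => eLpNorm (fun x => u n x - w x) 2 μ) atTop (𝓝 0)) :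
    Tendsto (fun n => ∫ x, k n x • u n x ∂μ) atTop (𝓝 (∫ x, f x • w x ∂μ)) := by
  have hi : Integrable (fun x => f x • w x) μ := memLp_one_iff_integrable.1 (hw.smul hf)
  refine tendsto_integral_of_L1' _ hi.1
    (Eventually.of_forall fun n => memLp_one_iff_integrable.1 ((hu n).smul (hk n))) ?_
  set a := fun n => eLpNorm (fun x => k n x - f x) 2 μ
  set b := fun n => eLpNorm (fun x => u n x - w x) 2 μ
  have hb : ∀ n, eLpNorm ((fun x => k n x • u n x) - fun x => f x • w x) 1 μ ≤
      a n * b n + a n * eLpNorm w 2 μ + eLpNorm f 2 μ * b n := fun n => by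
    have m1 := (hk n).1.sub hf.1
    have m2 := (hu n).1.sub hw.1
    -- Both factors are expanded around their limits, so Hölder's inequality needs only the norms of
    -- `f` and `w` and no uniform bound on the sequences.
    have e : ((fun x => k n x • u n x) - fun x => f x • w x) =
        (k n - f) • (u n - w) + (k n - f) • w + f • (u n - w) := by
      ext x
      simp only [Pi.sub_apply, Pi.add_apply, Pi.smul_apply', sub_smul, smul_sub]
      abel
    rw [e]
    refine (eLpNorm_add_le ((m1.smul m2).add (m1.smul hw.1)) (hf.1.smul m2) le_rfl).trans ?_
    refine add_le_add ((eLpNorm_add_le (m1.smul m2) (m1.smul hw.1) le_rfl).trans ?_) ?_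
    · exact add_le_add (eLpNorm_smul_le_mul_eLpNorm m2 m1) (eLpNorm_smul_le_mul_eLpNorm hw.1 m1)
    · exact eLpNorm_smul_le_mul_eLpNorm m2 hf.1
  refine tendsto_of_tendsto_of_tendsto_of_le_of_le tendsto_const_nhds ?_ (fun _ => zero_le) hb
  have t1 : Tendsto (fun n => a n * b n) atTop (𝓝 (0 * 0)) :=
    ENNReal.Tendsto.mul h (by simp) h' (by simp)
  have t2 : Tendsto (fun n => a n * eLpNorm w 2 μ) atTop (𝓝 (0 * eLpNorm w 2 μ)) :=
    ENNReal.Tendsto.mul_const h (Or.inr hw.2.ne)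
  have t3 : Tendsto (fun n => eLpNorm f 2 μ * b n) atTop (𝓝 (eLpNorm f 2 μ * 0)) :=
    ENNReal.Tendsto.const_mul h' (Or.inr hf.2.ne)
  simpa using (t1.add t2).add t3

theorem tendsto_integral_smul_const_of_tendsto_eLpNorm {μ : Measure Plane} {k : ℕ → Plane → ℝ}
    {f : Plane → ℝ} {w : Plane → F} (hk : ∀ n, MemLp (k n) 2 μ) (hf : MemLp f 2 μ)
    (hw : MemLp w 2 μ) (h : Tendsto (fun n => eLpNorm (fun x => k n x - f x) 2 μ) atTop (𝓝 0)) :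
    Tendsto (fun n => ∫ x, k n x • w x ∂μ) atTop (𝓝 (∫ x, f x • w x ∂μ)) :=
  tendsto_integral_smul_of_tendsto_eLpNorm hk hf (fun _ => hw) hw h (by simp)

/-- Near a compact set, an `H¹` function is the limit in `H¹` of test functions. -/
theorem exists_isTestFunction_tendsto_on_compact {K : Set Plane} (hΩ : IsOpen Ω) (hK : IsCompact K)
    (hKΩ : K ⊆ Ω) {f : Plane → ℝ} {g : Fin 2 → Plane → ℝ} (hf : MemLp f 2 (volume.restrict Ω))
    (hg : ∀ i, MemLp (g i) 2 (volume.restrict Ω)) (h : ∀ i, HasWeakPartial Ω i f (g i)) :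
    ∃ (k : ℕ → Plane → ℝ) (f' : Plane → ℝ) (g' : Fin 2 → Plane → ℝ),
      (∀ n, IsTestFunction Ω (k n)) ∧ MemLp f' 2 volume ∧ (∀ i, MemLp (g' i) 2 volume) ∧
      (∀ x ∈ K, f' x = f x) ∧ (∀ i, ∀ x ∈ K, g' i x = g i x) ∧
      Tendsto (fun n => eLpNorm (fun x => k n x - f' x) 2 volume) atTop (𝓝 0) ∧
      ∀ i, Tendsto (fun n => eLpNorm (fun x => fderiv ℝ (k n) x (stdVec i) - g' i x) 2 volume)
        atTop (𝓝 0) := by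
  obtain ⟨χ, hχ, hχ1⟩ := exists_isTestFunction_eq_one hΩ hK hKΩ
  have m1 : MemLp (fun x => χ x * f x) 2 volume := hχ.memLp_smul hΩ hf
  have m2 : ∀ i, MemLp (fun x => fderiv ℝ χ x (stdVec i) * f x + χ x * g i x) 2 volume := fun i =>
    ((hχ.fderiv_stdVec i).memLp_smul hΩ hf).add (hχ.memLp_smul hΩ (hg i))
  obtain ⟨k, hk, hk0, hk1⟩ := exists_isTestFunction_tendsto (f := fun x => χ x * f x) hΩ
    hχ.compact hχ.support (fun x hx => by simp [image_eq_zero_of_notMem_tsupport hx]) m1 m2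
    (fun i => (h i).cutoff hχ)
  refine ⟨k, _, _, hk, m1, m2, fun x hx => ?_, fun i x hx => ?_, hk0, hk1⟩
  · simp [hχ1.self_of_nhdsSet x hx]
  · have h1 : χ =ᶠ[𝓝 x] fun _ => 1 := eventually_nhdsSet_iff_forall.1 hχ1 x hx
    simp [h1.fderiv_eq, h1.eq_of_nhds]

/-- The product rule for weak derivatives of `H¹` functions. -/
theorem HasWeakPartial.smul {f : Plane → ℝ} {g : Fin 2 → Plane → ℝ} {v w : Plane → F} {i : Fin 2}
    (hΩ : IsOpen Ω) (hf : MemLp f 2 (volume.restrict Ω))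
    (hg : ∀ i, MemLp (g i) 2 (volume.restrict Ω)) (h : ∀ i, HasWeakPartial Ω i f (g i))
    (hv : MemLp v 2 (volume.restrict Ω)) (hw : MemLp w 2 (volume.restrict Ω))
    (hvw : HasWeakPartial Ω i v w) :
    HasWeakPartial Ω i (fun x => f x • v x) (fun x => g i x • v x + f x • w x) := by
  have j1 : Integrable (fun x => f x • v x) (volume.restrict Ω) :=
    memLp_one_iff_integrable.1 (hv.smul hf)
  have j2 : Integrable (fun x => g i x • v x) (volume.restrict Ω) :=
    memLp_one_iff_integrable.1 (hv.smul (hg i))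
  have j3 : Integrable (fun x => f x • w x) (volume.restrict Ω) :=
    memLp_one_iff_integrable.1 (hw.smul hf)
  have l2 : LocallyIntegrableOn (fun x => g i x • v x) Ω volume :=
    IntegrableOn.locallyIntegrableOn j2
  have l3 : LocallyIntegrableOn (fun x => f x • w x) Ω volume :=
    IntegrableOn.locallyIntegrableOn j3
  refine of_integral_smul_eq (IntegrableOn.locallyIntegrableOn j1) (l2.add l3) fun ψ hψ => ?_
  -- Only `f` is approximated, and only near the support of `ψ`. For smooth `k n` the product rule
  -- is the weak derivative of `v` tested with `ψ * k n`; each integral then passes to the limit.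
  obtain ⟨k, f', g', hk, hf', hg', hff', hgg', hk0, hk1⟩ :=
    exists_isTestFunction_tendsto_on_compact hΩ hψ.compact hψ.support hf hg h
  have hψv := hψ.memLp_smul hΩ hv
  have hψw := hψ.memLp_smul hΩ hw
  have hdv := (hψ.fderiv_stdVec i).memLp_smul hΩ hv
  have T1 := tendsto_integral_smul_const_of_tendsto_eLpNorm (fun n => (hk n).memLp 2) hf' hdv hk0
  have T2 := tendsto_integral_smul_const_of_tendsto_eLpNorm
    (fun n => ((hk n).fderiv_stdVec i).memLp 2) (hg' i) hψv (hk1 i)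
  have T3 := tendsto_integral_smul_const_of_tendsto_eLpNorm (fun n => (hk n).memLp 2) hf' hψw hk0
  have key : ∀ n, (∫ x, k n x • fderiv ℝ ψ x (stdVec i) • v x) +
      ∫ x, fderiv ℝ (k n) x (stdVec i) • ψ x • v x = -∫ x, k n x • ψ x • w x := fun n => by
    have e := hvw.integral_smul_eq (hψ.mul_contDiff (hk n).smooth)
    have hd : ∀ x, fderiv ℝ (fun x => ψ x * k n x) x (stdVec i) =
        k n x * fderiv ℝ ψ x (stdVec i) + fderiv ℝ (k n) x (stdVec i) * ψ x := fun x => by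
      rw [fderiv_fun_mul (hψ.smooth.differentiable (by simp) x)
        ((hk n).smooth.differentiable (by simp) x)]
      simp; ring
    simp only [hd, add_smul, mul_smul] at e
    have q1 : Integrable (fun x => k n x • fderiv ℝ ψ x (stdVec i) • v x) volume :=
      memLp_one_iff_integrable.1 (hdv.smul ((hk n).memLp 2))
    have q2 : Integrable (fun x => fderiv ℝ (k n) x (stdVec i) • ψ x • v x) volume :=
      memLp_one_iff_integrable.1 (hψv.smul (((hk n).fderiv_stdVec i).memLp 2))
    rw [integral_add q1 q2] at e
    rw [e]
    congr 2; ext x; rw [smul_comm]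
  have lim := tendsto_nhds_unique ((T1.add T2).congr key) T3.neg
  have p0 : ∀ x, ψ x = 0 ∨ x ∈ tsupport ψ := fun x => by
    by_cases hx : x ∈ tsupport ψ
    · exact Or.inr hx
    · exact Or.inl (image_eq_zero_of_notMem_tsupport hx)
  have e1 : ∀ x, f' x • fderiv ℝ ψ x (stdVec i) • v x = fderiv ℝ ψ x (stdVec i) • f x • v x := by
    intro x
    by_cases hx : x ∈ tsupport ψ
    · rw [hff' x hx, smul_comm]
    · simp [fderiv_of_notMem_tsupport ℝ hx]
  have e2 : ∀ x, g' i x • ψ x • v x = ψ x • g i x • v x := fun x => by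
    rcases p0 x with hx | hx
    · simp [hx]
    · rw [hgg' i x hx, smul_comm]
  have e3 : ∀ x, f' x • ψ x • w x = ψ x • f x • w x := fun x => by
    rcases p0 x with hx | hx
    · simp [hx]
    · rw [hff' x hx, smul_comm]
  simp only [e1, e2, e3] at lim
  simp only [smul_add]
  rw [integral_add (hψ.integrable_smul l2) (hψ.integrable_smul l3), neg_add, ← lim]
  abel

theorem tendsto_eLpNorm_comp_sub_comp {G : ℝ → ℝ} {L : NNReal} (hG : LipschitzWith L G)
    {a : ℕ → Plane → ℝ} {b : Plane → ℝ}
    (h : Tendsto (fun n => eLpNorm (fun x => a n x - b x) 2 volume) atTop (𝓝 0)) :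
    Tendsto (fun n => eLpNorm (fun x => G (a n x) - G (b x)) 2 volume) atTop (𝓝 0) := by
  have hb : ∀ n, eLpNorm (fun x => G (a n x) - G (b x)) 2 volume ≤
      ENNReal.ofReal L * eLpNorm (fun x => a n x - b x) 2 volume := fun n =>
    eLpNorm_le_mul_eLpNorm_of_ae_le_mul (Eventually.of_forall fun x => hG.norm_sub_le _ _) 2
  refine tendsto_of_tendsto_of_tendsto_of_le_of_le tendsto_const_nhds ?_ (fun _ => zero_le) hb
  simpa using ENNReal.Tendsto.const_mul h (Or.inr (ENNReal.ofReal_ne_top (r := L)))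

/-- The chain rule for weak derivatives of `H¹` functions. -/
theorem HasWeakPartial.comp {f : Plane → ℝ} {g : Fin 2 → Plane → ℝ} (hΩ : IsOpen Ω)
    (hf : MemLp f 2 (volume.restrict Ω)) (hg : ∀ i, MemLp (g i) 2 (volume.restrict Ω))
    (h : ∀ i, HasWeakPartial Ω i f (g i)) {G G' : ℝ → ℝ} {C L : NNReal} (hG0 : G 0 = 0)
    (hG : ∀ t, HasDerivAt G (G' t) t) (hC : ∀ t, ‖G' t‖₊ ≤ C) (hL : LipschitzWith L G')
    (i : Fin 2) : MemLp (fun x => G (f x)) 2 (volume.restrict Ω) ∧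
      MemLp (fun x => G' (f x) * g i x) 2 (volume.restrict Ω) ∧
      HasWeakPartial Ω i (fun x => G (f x)) (fun x => G' (f x) * g i x) := by
  have hGL : LipschitzWith C G := lipschitzWith_of_nnnorm_deriv_le
    (fun t => (hG t).differentiableAt) fun t => by rw [(hG t).deriv]; exact hC t
  have hm1 : MemLp (fun x => G (f x)) 2 (volume.restrict Ω) := hGL.comp_memLp hG0 hf
  have hm2 : MemLp (fun x => G' (f x) * g i x) 2 (volume.restrict Ω) :=
    (hg i).smul (memLp_top_of_bound (hL.continuous.comp_aestronglyMeasurable hf.1) C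
      (Eventually.of_forall fun x => hC (f x)))
  refine ⟨hm1, hm2, of_integral_smul_eq (MemLp.locallyIntegrableOn hm1)
    (MemLp.locallyIntegrableOn hm2) fun ψ hψ => ?_⟩
  obtain ⟨k, f', g', hk, hf', hg', hff', hgg', hk0, hk1⟩ :=
    exists_isTestFunction_tendsto_on_compact hΩ hψ.compact hψ.support hf hg h
  obtain ⟨B, hB⟩ := hψ.exists_norm_le
  have hψG : ∀ u : Plane → ℝ, AEStronglyMeasurable u volume →
      MemLp (fun x => ψ x * G' (u x)) 2 volume := fun u hu =>
    (memLp_top_of_bound (hL.continuous.comp_aestronglyMeasurable hu) C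
      (Eventually.of_forall fun x => hC (u x))).smul (hψ.memLp 2)
  -- Since `G'` is Lipschitz, `G' (k n)` converges in `L²` without passing to subsequences. The
  -- factor `ψ` makes the functions themselves square integrable, as `G' 0` need not vanish.
  have c1 : Tendsto (fun n => eLpNorm (fun x => ψ x * G' (k n x) - ψ x * G' (f' x)) 2 volume)
      atTop (𝓝 0) := by
    have hb : ∀ n, eLpNorm (fun x => ψ x * G' (k n x) - ψ x * G' (f' x)) 2 volume ≤
        ENNReal.ofReal B * eLpNorm (fun x => G' (k n x) - G' (f' x)) 2 volume := fun n => by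
      refine eLpNorm_le_mul_eLpNorm_of_ae_le_mul (Eventually.of_forall fun x => ?_) 2
      rw [← mul_sub, norm_mul]
      exact mul_le_mul_of_nonneg_right (hB x) (norm_nonneg _)
    refine tendsto_of_tendsto_of_tendsto_of_le_of_le tendsto_const_nhds ?_ (fun _ => zero_le) hb
    simpa using ENNReal.Tendsto.const_mul (tendsto_eLpNorm_comp_sub_comp hL hk0)
      (Or.inr (ENNReal.ofReal_ne_top (r := B)))
  have T1 := tendsto_integral_smul_const_of_tendsto_eLpNorm
    (fun n => hGL.comp_memLp hG0 ((hk n).memLp 2)) (hGL.comp_memLp hG0 hf')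
    ((hψ.fderiv_stdVec i).memLp 2) (tendsto_eLpNorm_comp_sub_comp hGL hk0)
  have T2 := tendsto_integral_smul_of_tendsto_eLpNorm
    (fun n => ((hk n).fderiv_stdVec i).memLp 2) (hg' i)
    (fun n => hψG _ ((hk n).memLp 2).1) (hψG _ hf'.1) (hk1 i) c1
  have key : ∀ n, ∫ x, G (k n x) * fderiv ℝ ψ x (stdVec i) =
      -∫ x, fderiv ℝ (k n) x (stdVec i) * (ψ x * G' (k n x)) := fun n => by
    have hkd : Differentiable ℝ (k n) := (hk n).smooth.differentiable (by simp)
    have hd : ∀ x, HasFDerivAt (fun x => G (k n x)) (G' (k n x) • fderiv ℝ (k n) x) x := fun x =>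
      (hG (k n x)).comp_hasFDerivAt x (hkd x).hasFDerivAt
    have hGk : MemLp (fun x => G (k n x)) 2 volume := hGL.comp_memLp hG0 ((hk n).memLp 2)
    have e := integral_mul_fderiv_eq_neg_fderiv_mul_of_integrable (μ := volume)
      (f := fun x => G (k n x)) (g := ψ) (v := stdVec i)
      (by
        simp only [fun x => (hd x).fderiv]
        have := memLp_one_iff_integrable.1
          ((hψG _ ((hk n).memLp 2).1).mul (((hk n).fderiv_stdVec i).memLp 2) (r := 1))
        refine this.congr (Eventually.of_forall fun x => ?_)
        simp; ring)
      (memLp_one_iff_integrable.1 (((hψ.fderiv_stdVec i).memLp 2).mul hGk (r := 1)))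
      (memLp_one_iff_integrable.1 ((hψ.memLp 2).mul hGk (r := 1)))
      (fun x _ => (hd x).differentiableAt) (fun x _ => hψ.smooth.differentiable (by simp) x)
    rw [e]
    congr 2; ext x
    rw [(hd x).fderiv]
    simp; ring
  have lim := tendsto_nhds_unique (T1.congr key) T2.neg
  have e1 : ∀ x, G (f' x) • fderiv ℝ ψ x (stdVec i) = fderiv ℝ ψ x (stdVec i) • G (f x) := by
    intro x
    by_cases hx : x ∈ tsupport ψ
    · rw [hff' x hx, smul_eq_mul, smul_eq_mul, mul_comm]
    · simp [fderiv_of_notMem_tsupport ℝ hx]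
  have e2 : ∀ x, g' i x • (ψ x * G' (f' x)) = ψ x • (G' (f x) * g i x) := fun x => by
    by_cases hx : x ∈ tsupport ψ
    · rw [hgg' i x hx, hff' x hx, smul_eq_mul, smul_eq_mul]
      ring
    · simp [image_eq_zero_of_notMem_tsupport hx]
  simpa only [Function.comp_apply, e1, e2] using lim

end WeakCalculus

/-! ### Radial kernels and potentials in the plane -/

section MeanValue

/-- A smooth step from `0` on `(-∞, 1/2]` to `1` on `[1, ∞)`. -/
noncomputable def smoothStep (t : ℝ) : ℝ := Real.smoothTransition (2 * t - 1)

theorem contDiff_smoothStep : ContDiff ℝ ∞ smoothStep :=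
  Real.smoothTransition.contDiff.comp ((contDiff_const.mul contDiff_id).sub contDiff_const)

theorem monotone_smoothStep : Monotone smoothStep := fun a b h =>
  Real.smoothTransition.monotone (by linarith)

theorem smoothStep_of_le {t : ℝ} (h : t ≤ 1 / 2) : smoothStep t = 0 :=
  Real.smoothTransition.zero_of_nonpos (by linarith)

theorem smoothStep_of_ge {t : ℝ} (h : 1 ≤ t) : smoothStep t = 1 :=
  Real.smoothTransition.one_of_one_le (by linarith)

theorem hasDerivAt_smoothStep (t : ℝ) : HasDerivAt smoothStep (deriv smoothStep t) t :=
  (contDiff_smoothStep.differentiable (by simp) t).hasDerivAt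

theorem continuous_deriv_smoothStep : Continuous (deriv smoothStep) :=
  contDiff_smoothStep.continuous_deriv (by simp)

theorem deriv_smoothStep_nonneg (t : ℝ) : 0 ≤ deriv smoothStep t :=
  monotone_smoothStep.deriv_nonneg

theorem deriv_smoothStep_of_gt {t : ℝ} (h : 1 < t) : deriv smoothStep t = 0 := by
  have : smoothStep =ᶠ[𝓝 t] fun _ => 1 := by
    filter_upwards [lt_mem_nhds h] with s hs using smoothStep_of_ge hs.le
  rw [this.deriv_eq, deriv_const]

theorem deriv_smoothStep_of_lt {t : ℝ} (h : t < 1 / 2) : deriv smoothStep t = 0 := by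
  have : smoothStep =ᶠ[𝓝 t] fun _ => 0 := by
    filter_upwards [gt_mem_nhds h] with s hs using smoothStep_of_le hs.le
  rw [this.deriv_eq, deriv_const]

theorem hasCompactSupport_deriv_smoothStep : HasCompactSupport (deriv smoothStep) :=
  HasCompactSupport.of_support_subset_isCompact (isCompact_Icc (a := (1 / 2 : ℝ)) (b := 1))
    fun t ht => by
      refine ⟨?_, ?_⟩ <;> by_contra! h
      · exact ht (deriv_smoothStep_of_lt h)
      · exact ht (deriv_smoothStep_of_gt h)

/-- The radial mollifier at scale `r` (not normalized). -/
noncomputable def radialKernel (r : ℝ) (y : Plane) : ℝ := deriv smoothStep (‖y‖ ^ 2 / r ^ 2) / r ^ 2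

theorem continuous_radialKernel (r : ℝ) : Continuous (radialKernel r) :=
  (continuous_deriv_smoothStep.comp ((continuous_norm.pow 2).div_const _)).div_const _

theorem radialKernel_nonneg (r : ℝ) (y : Plane) : 0 ≤ radialKernel r y :=
  div_nonneg (deriv_smoothStep_nonneg _) (sq_nonneg r)

theorem radialKernel_eq_zero {r : ℝ} (hr : 0 < r) {y : Plane} (hy : y ∉ Metric.closedBall 0 r) :
    radialKernel r y = 0 := by
  rw [mem_closedBall_zero_iff, not_le] at hy
  rw [radialKernel, deriv_smoothStep_of_gt, zero_div]
  rw [one_lt_div (by positivity)]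
  gcongr

theorem hasCompactSupport_radialKernel {r : ℝ} (hr : 0 < r) : HasCompactSupport (radialKernel r) :=
  HasCompactSupport.of_support_subset_isCompact (isCompact_closedBall (0 : Plane) r) fun y hy => by
    by_contra h
    exact hy (radialKernel_eq_zero hr h)

theorem exists_radialKernel_le : ∃ B : ℝ, 0 ≤ B ∧ ∀ r y, radialKernel r y ≤ B / r ^ 2 := by
  obtain ⟨B, hB⟩ :=
    continuous_deriv_smoothStep.bounded_above_of_compact_support hasCompactSupport_deriv_smoothStep
  refine ⟨B, (norm_nonneg _).trans (hB 0), fun r y => ?_⟩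
  exact div_le_div_of_nonneg_right ((le_abs_self _).trans (hB _)) (sq_nonneg r)

/-- Scaling: in dimension two the factor `1 / r ^ 2` compensates the Jacobian of `y ↦ r⁻¹ • y`. -/
theorem integral_radialKernel {r : ℝ} (hr : 0 < r) :
    ∫ y, radialKernel r y = ∫ y, radialKernel 1 y := by
  have h := Measure.integral_comp_inv_smul_of_nonneg (volume : Measure Plane) (radialKernel 1) hr.le
  have e : ∀ y, radialKernel r y = (r ^ 2)⁻¹ * radialKernel 1 (r⁻¹ • y) := fun y => by
    simp only [radialKernel, norm_smul, norm_inv, Real.norm_eq_abs, mul_pow, inv_pow, sq_abs,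
      one_pow, div_one]
    rw [inv_mul_eq_div, inv_mul_eq_div]
  simp only [e]
  rw [integral_const_mul, h]
  simp only [finrank_euclideanSpace, Fintype.card_fin, smul_eq_mul]
  field_simp

theorem integral_radialKernel_pos : 0 < ∫ y, radialKernel 1 y := by
  -- The mean value theorem provides `t` where the step has slope `2`; the kernel is then positive
  -- at a point of norm `√t`.
  obtain ⟨t, ht, ht'⟩ := exists_hasDerivAt_eq_slope smoothStep (deriv smoothStep)
    (a := 1 / 2) (b := 1) (by norm_num) contDiff_smoothStep.continuous.continuousOn
    fun t _ => hasDerivAt_smoothStep t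
  rw [smoothStep_of_le le_rfl, smoothStep_of_ge le_rfl] at ht'
  refine (continuous_radialKernel 1).integral_pos_of_hasCompactSupport_nonneg_nonzero
    (hasCompactSupport_radialKernel one_pos) (radialKernel_nonneg 1)
    (x := EuclideanSpace.single 0 (Real.sqrt t)) ?_
  have h0 : 0 ≤ t := by linarith [ht.1]
  simp only [radialKernel, PiLp.norm_single, Real.norm_eq_abs, sq_abs, Real.sq_sqrt h0,
    one_pow, div_one, ht']
  norm_num

/-- The profile of the gradient of the difference of two radial potentials. -/
noncomputable def radialSlope (δ r s : ℝ) : ℝ :=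
  (smoothStep (s / δ ^ 2) - smoothStep (s / r ^ 2)) / (4 * s)

section

variable {δ r : ℝ} (hδ : 0 < δ) (hr : δ < r)

include hδ hr

theorem radialSlope_of_le {s : ℝ} (h : s ≤ δ ^ 2 / 2) : radialSlope δ r s = 0 := by
  have h1 : s / δ ^ 2 ≤ 1 / 2 := by rw [div_le_iff₀ (by positivity)]; linarith
  have hr0 : 0 < r := hδ.trans hr
  have h2 : s / r ^ 2 ≤ 1 / 2 := by
    rw [div_le_iff₀ (by positivity)]
    nlinarith
  rw [radialSlope, smoothStep_of_le h1, smoothStep_of_le h2]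
  simp

theorem radialSlope_of_ge {s : ℝ} (h : r ^ 2 ≤ s) : radialSlope δ r s = 0 := by
  have hr0 : 0 < r := hδ.trans hr
  have h1 : 1 ≤ s / r ^ 2 := by rw [one_le_div (by positivity)]; exact h
  have h2 : 1 ≤ s / δ ^ 2 := by
    rw [one_le_div (by positivity)]
    nlinarith
  rw [radialSlope, smoothStep_of_ge h1, smoothStep_of_ge h2]
  simp

theorem radialSlope_nonneg (s : ℝ) : 0 ≤ radialSlope δ r s := by
  rcases le_total s (δ ^ 2 / 2) with h | h
  · rw [radialSlope_of_le hδ hr h]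
  · have hs : 0 < s := lt_of_lt_of_le (by positivity) h
    refine div_nonneg (sub_nonneg.2 (monotone_smoothStep ?_)) (by positivity)
    gcongr

/-- The division by `4 * s` is harmless, since both steps vanish for `s ≤ δ ^ 2 / 2`. -/
theorem contDiff_radialSlope : ContDiff ℝ ∞ (radialSlope δ r) := by
  rw [contDiff_iff_contDiffAt]
  intro s
  rcases lt_or_ge s (δ ^ 2 / 2) with h | h
  · have : radialSlope δ r =ᶠ[𝓝 s] fun _ => 0 := by
      filter_upwards [gt_mem_nhds h] with t ht using radialSlope_of_le hδ hr ht.le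
    exact contDiffAt_const.congr_of_eventuallyEq this
  · have hs : 0 < s := lt_of_lt_of_le (by positivity) h
    refine ContDiffAt.div (ContDiff.contDiffAt ?_) (by fun_prop) (by positivity)
    exact (contDiff_smoothStep.comp (contDiff_id.div_const _)).sub
      (contDiff_smoothStep.comp (contDiff_id.div_const _))

omit hδ hr in
theorem mul_radialSlope (s : ℝ) :
    s * radialSlope δ r s = (smoothStep (s / δ ^ 2) - smoothStep (s / r ^ 2)) / 4 := by
  rcases eq_or_ne s 0 with rfl | hs
  · simp [smoothStep_of_le]
  · rw [radialSlope]; field_simp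

theorem hasDerivAt_radialSlope (s : ℝ) :
    HasDerivAt (radialSlope δ r) (deriv (radialSlope δ r) s) s :=
  ((contDiff_radialSlope hδ hr).differentiable (by simp) s).hasDerivAt

theorem radialSlope_add_mul_deriv (s : ℝ) :
    radialSlope δ r s + s * deriv (radialSlope δ r) s =
      (deriv smoothStep (s / δ ^ 2) / δ ^ 2 - deriv smoothStep (s / r ^ 2) / r ^ 2) / 4 := by
  have h1 := (hasDerivAt_id s).mul (hasDerivAt_radialSlope hδ hr s)
  have h2 : ∀ a : ℝ, HasDerivAt (fun s => smoothStep (s / a)) (deriv smoothStep (s / a) / a) s :=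
    fun a => by
      have : HasDerivAt (fun s => smoothStep (s / a)) (deriv smoothStep (s / a) * (1 / a)) s :=
        HasDerivAt.comp (h₂ := smoothStep) (h := fun s => s / a) s (hasDerivAt_smoothStep (s / a))
          ((hasDerivAt_id s).div_const a)
      rwa [mul_one_div] at this
  have h3 := ((h2 (δ ^ 2)).sub (h2 (r ^ 2))).div_const 4
  have h4 : (id * radialSlope δ r) =
      fun s => (smoothStep (s / δ ^ 2) - smoothStep (s / r ^ 2)) / 4 := by
    ext s; exact mul_radialSlope s
  rw [h4] at h1
  have := h1.unique h3
  simpa using this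

end

/-- The profile of the difference of two radial potentials. -/
noncomputable def radialProfile (δ r s : ℝ) : ℝ := ∫ t in s..(r ^ 2), radialSlope δ r t

/-- The difference of the potentials of the radial mollifiers at scales `δ < r`. -/
noncomputable def radialPotential (δ r : ℝ) (x y : Plane) : ℝ := radialProfile δ r (‖y - x‖ ^ 2)

section

variable {δ r : ℝ} (hδ : 0 < δ) (hr : δ < r)

include hδ hr

theorem hasDerivAt_radialProfile (s : ℝ) :
    HasDerivAt (radialProfile δ r) (-radialSlope δ r s) s := by
  have hc := (contDiff_radialSlope hδ hr).continuous
  exact intervalIntegral.integral_hasDerivAt_left (hc.intervalIntegrable _ _)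
    (hc.stronglyMeasurableAtFilter _ _) hc.continuousAt

theorem contDiff_radialProfile : ContDiff ℝ ∞ (radialProfile δ r) := by
  rw [contDiff_infty_iff_deriv]
  refine ⟨fun s => (hasDerivAt_radialProfile hδ hr s).differentiableAt, ?_⟩
  rw [funext fun s => (hasDerivAt_radialProfile hδ hr s).deriv]
  exact (contDiff_radialSlope hδ hr).neg

theorem radialProfile_of_ge {s : ℝ} (h : r ^ 2 ≤ s) : radialProfile δ r s = 0 := by
  rw [radialProfile]
  refine (intervalIntegral.integral_congr fun t ht => ?_).trans intervalIntegral.integral_zero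
  rw [uIcc_of_ge h] at ht
  exact radialSlope_of_ge hδ hr ht.1

theorem radialProfile_nonneg (s : ℝ) : 0 ≤ radialProfile δ r s := by
  rcases le_total s (r ^ 2) with h | h
  · exact intervalIntegral.integral_nonneg h fun t _ => radialSlope_nonneg hδ hr t
  · rw [radialProfile_of_ge hδ hr h]

theorem isTestFunction_radialPotential {Ω : Set Plane} {x : Plane}
    (hx : Metric.closedBall x r ⊆ Ω) : IsTestFunction Ω (radialPotential δ r x) := by
  have hs : Function.support (radialPotential δ r x) ⊆ Metric.closedBall x r := fun y hy => by
    by_contra h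
    rw [mem_closedBall_iff_norm, not_le] at h
    refine hy (radialProfile_of_ge hδ hr ?_)
    have : 0 < r := hδ.trans hr
    gcongr
  refine ⟨?_, HasCompactSupport.of_support_subset_isCompact (isCompact_closedBall x r) hs,
    (closure_minimal hs Metric.isClosed_closedBall).trans hx⟩
  exact (contDiff_radialProfile hδ hr).comp ((contDiff_id.sub contDiff_const).norm_sq ℝ)

/-- In the plane, a function `p(|y - x|²)` has Laplacian `4 (s p'(s))'` at `s = |y - x|²`. Here `p'
= -radialSlope`, and `radialSlope` was chosen so that `4 s * radialSlope` is a difference of two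
steps, whose derivatives are the kernels. -/
theorem laplacian_radialPotential (x y : Plane) :
    ∑ i, fderiv ℝ (fun y => fderiv ℝ (radialPotential δ r x) y (stdVec i)) y (stdVec i) =
      radialKernel r (y - x) - radialKernel δ (y - x) := by
  have hs : ∀ y, HasFDerivAt (fun y : Plane => ‖y - x‖ ^ 2) (2 • innerSL ℝ (y - x)) y := fun y => by
    simpa using ((hasFDerivAt_id y).sub_const x).norm_sq
  have hin : ∀ (y : Plane) i, (2 • innerSL ℝ (y - x)) (stdVec i) = 2 * (y i - x i) := fun y i => by
    simp [stdVec, EuclideanSpace.inner_single_right]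
  have h1 : ∀ y i, fderiv ℝ (radialPotential δ r x) y (stdVec i) =
      -2 * (radialSlope δ r (‖y - x‖ ^ 2) * (y i - x i)) := fun y i => by
    have := (hasDerivAt_radialProfile hδ hr (‖y - x‖ ^ 2)).comp_hasFDerivAt y (hs y)
    have h' : HasFDerivAt (radialPotential δ r x)
      (-radialSlope δ r (‖y - x‖ ^ 2) • (2 • innerSL ℝ (y - x))) y := this
    rw [h'.fderiv, smul_apply, hin, smul_eq_mul]
    ring
  have h2 : ∀ i, fderiv ℝ (fun y => fderiv ℝ (radialPotential δ r x) y (stdVec i)) y (stdVec i) =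
      -2 * (radialSlope δ r (‖y - x‖ ^ 2) +
        2 * (y i - x i) ^ 2 * deriv (radialSlope δ r) (‖y - x‖ ^ 2)) := fun i => by
    have a1 : HasFDerivAt (fun y : Plane => radialSlope δ r (‖y - x‖ ^ 2))
        (deriv (radialSlope δ r) (‖y - x‖ ^ 2) • (2 • innerSL ℝ (y - x))) y :=
      HasDerivAt.comp_hasFDerivAt (h₂ := radialSlope δ r) (f := fun y : Plane => ‖y - x‖ ^ 2) y
        (hasDerivAt_radialSlope hδ hr (‖y - x‖ ^ 2)) (hs y)
    have a2 : HasFDerivAt (fun y : Plane => y i - x i)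
        (EuclideanSpace.proj i : Plane →L[ℝ] ℝ) y :=
      (EuclideanSpace.proj i : Plane →L[ℝ] ℝ).hasFDerivAt.sub_const (x i)
    simp only [h1]
    rw [((a1.fun_mul a2).const_mul (-2)).fderiv]
    simp only [smul_apply, add_apply, hin, smul_eq_mul]
    simp [stdVec]
    ring
  simp only [h2]
  have h3 : ‖y - x‖ ^ 2 = (y 0 - x 0) ^ 2 + (y 1 - x 1) ^ 2 := by
    simp [EuclideanSpace.norm_sq_eq, Fin.sum_univ_two]
  have h4 := radialSlope_add_mul_deriv hδ hr (‖y - x‖ ^ 2)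
  rw [Fin.sum_univ_two, radialKernel, radialKernel]
  linear_combination (-4) * h4 + 4 * deriv (radialSlope δ r) (‖y - x‖ ^ 2) * h3

end

end MeanValue

/-! ### Local upper bounds for weakly subharmonic functions -/

section Subharmonic

/-- Convergence holds at every Lebesgue point: the kernel is at most `B / δ ^ 2` and lives on a disk
of area proportional to `δ ^ 2`, so the error is controlled by the mean oscillation of `U` on that
disk. -/
theorem ae_tendsto_integral_radialKernel {U : Plane → ℝ} (hU : LocallyIntegrable U volume) :
    ∀ᵐ x, Tendsto (fun δ => ∫ y, radialKernel δ (y - x) * U y) (𝓝[>] 0)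
      (𝓝 ((∫ y, radialKernel 1 y) * U x)) := by
  obtain ⟨B, hB0, hB⟩ := exists_radialKernel_le
  filter_upwards [(Besicovitch.vitaliFamily (volume : Measure Plane)).ae_tendsto_average_norm_sub
    hU] with x hx
  have hx' := hx.comp (Besicovitch.tendsto_filterAt (volume : Measure Plane) x)
  set c : ℝ := B * volume.real (Metric.ball (0 : Plane) 1)
  rw [tendsto_iff_norm_sub_tendsto_zero]
  have hb : ∀ δ ∈ Ioi (0 : ℝ), ‖(∫ y, radialKernel δ (y - x) * U y) -
      (∫ y, radialKernel 1 y) * U x‖ ≤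
      c * ⨍ y in Metric.closedBall x δ, ‖U y - U x‖ := by
    intro δ (hδ : 0 < δ)
    have hcont : Continuous fun y => radialKernel δ (y - x) :=
      (continuous_radialKernel δ).comp (continuous_id.sub continuous_const)
    have hcs : HasCompactSupport fun y => radialKernel δ (y - x) :=
      (hasCompactSupport_radialKernel hδ).comp_homeomorph (Homeomorph.subRight x)
    have i1 : Integrable (fun y => radialKernel δ (y - x) * U y) volume :=
      hU.integrable_smul_left_of_hasCompactSupport hcont hcs
    have i2 : Integrable (fun y => radialKernel δ (y - x) * U x) volume :=
      (hcont.integrable_of_hasCompactSupport hcs).mul_const _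
    have e1 : (∫ y, radialKernel 1 y) * U x = ∫ y, radialKernel δ (y - x) * U x := by
      rw [integral_mul_const, integral_sub_right_eq_self (radialKernel δ) x,
        integral_radialKernel hδ]
    have iUx : IntegrableOn (fun y => ‖U y - U x‖) (Metric.closedBall x δ) volume :=
      (((hU.integrableOn_isCompact (isCompact_closedBall x δ)).sub
        (integrableOn_const measure_closedBall_lt_top.ne))).norm
    have hvol : volume.real (Metric.closedBall x δ) =
        δ ^ 2 * volume.real (Metric.ball (0 : Plane) 1) := by
      rw [Measure.addHaar_real_closedBall _ _ hδ.le]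
      simp
    rw [e1, ← integral_sub i1 i2]
    calc ‖∫ y, radialKernel δ (y - x) * U y - radialKernel δ (y - x) * U x‖
        = ‖∫ y in Metric.closedBall x δ,
            (radialKernel δ (y - x) * U y - radialKernel δ (y - x) * U x)‖ := by
          rw [setIntegral_eq_integral_of_forall_compl_eq_zero]
          intro y hy
          rw [radialKernel_eq_zero hδ (by simpa [dist_eq_norm] using hy)]
          simp
      _ ≤ ∫ y in Metric.closedBall x δ, B / δ ^ 2 * ‖U y - U x‖ := by
          refine norm_integral_le_of_norm_le (iUx.const_mul _) (Eventually.of_forall fun y => ?_)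
          rw [← mul_sub, norm_mul, Real.norm_of_nonneg (radialKernel_nonneg _ _)]
          exact mul_le_mul_of_nonneg_right (hB _ _) (norm_nonneg _)
      _ = c * ⨍ y in Metric.closedBall x δ, ‖U y - U x‖ := by
          have hpos : 0 < volume.real (Metric.ball (0 : Plane) 1) :=
            ENNReal.toReal_pos (Metric.measure_ball_pos _ _ one_pos).ne' measure_ball_lt_top.ne
          rw [integral_const_mul, setAverage_eq, hvol, smul_eq_mul]
          simp only [c]
          field_simp
  refine squeeze_zero' (Eventually.of_forall fun _ => norm_nonneg _)
    (eventually_nhdsWithin_of_forall hb) ?_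
  simpa using hx'.const_mul c

/-- Weakly subharmonic integrable functions are bounded above on compact sets. -/
theorem exists_ae_le_of_subharmonic {Ω K : Set Plane} (hΩ : IsOpen Ω) (hK : IsCompact K)
    (hKΩ : K ⊆ Ω) {u : Plane → ℝ} (hu : IntegrableOn u Ω volume)
    (hsub : ∀ η : Plane → ℝ, IsTestFunction Ω η → (∀ x, 0 ≤ η x) →
      0 ≤ ∫ x, (∑ i, fderiv ℝ (fun y => fderiv ℝ η y (stdVec i)) x (stdVec i)) * u x) :
    ∃ C, ∀ᵐ x ∂(volume.restrict K), u x ≤ C := by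
  obtain ⟨r, hr, hrΩ⟩ := hK.exists_cthickening_subset_open hΩ hKΩ
  obtain ⟨B, hB0, hB⟩ := exists_radialKernel_le
  set U := Ω.indicator u
  have hU : Integrable U volume := hu.integrable_indicator hΩ.measurableSet
  set m := ∫ y, radialKernel 1 y
  have hm : 0 < m := integral_radialKernel_pos
  refine ⟨(B / r ^ 2 * ∫ y, ‖U y‖) / m, ?_⟩
  rw [ae_restrict_iff' hK.measurableSet]
  filter_upwards [ae_tendsto_integral_radialKernel hU.locallyIntegrable] with x hx hxK
  have hball : Metric.closedBall x r ⊆ Ω :=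
    (Metric.closedBall_subset_cthickening hxK r).trans hrΩ
  have hxU : U x = u x := indicator_of_mem (hKΩ hxK) u
  have hint : ∀ δ, 0 < δ → Integrable (fun y => radialKernel δ (y - x) * U y) volume := fun δ hδ =>
    hU.locallyIntegrable.integrable_smul_left_of_hasCompactSupport
      ((continuous_radialKernel δ).comp (continuous_id.sub continuous_const))
      ((hasCompactSupport_radialKernel hδ).comp_homeomorph (Homeomorph.subRight x))
  -- Testing subharmonicity with the nonnegative `radialPotential δ r x` says that the average at
  -- scale `δ` is at most the one at scale `r`, which is bounded uniformly in `x` and `δ` by the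
  -- `L¹` norm.
  have hle : ∀ᶠ δ in 𝓝[>] (0 : ℝ),
      ∫ y, radialKernel δ (y - x) * U y ≤ B / r ^ 2 * ∫ y, ‖U y‖ := by
    filter_upwards [Ioo_mem_nhdsGT hr] with δ hδ
    have h0 := hsub _ (isTestFunction_radialPotential hδ.1 hδ.2 hball)
      fun y => radialProfile_nonneg hδ.1 hδ.2 _
    simp only [laplacian_radialPotential hδ.1 hδ.2] at h0
    have e : ∀ y, (radialKernel r (y - x) - radialKernel δ (y - x)) * u y =
        radialKernel r (y - x) * U y - radialKernel δ (y - x) * U y := fun y => by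
      by_cases hy : y ∈ Ω
      · simp only [U, indicator_of_mem hy]; ring
      · have hy' : y - x ∉ Metric.closedBall (0 : Plane) r := fun h =>
          hy (hball (by simpa [dist_eq_norm] using h))
        have hy'' : y - x ∉ Metric.closedBall (0 : Plane) δ := fun h =>
          hy' (Metric.closedBall_subset_closedBall hδ.2.le h)
        simp [radialKernel_eq_zero hr hy', radialKernel_eq_zero hδ.1 hy'']
    simp only [e] at h0
    rw [integral_sub (hint r hr) (hint δ hδ.1), sub_nonneg] at h0
    refine h0.trans ?_
    rw [← integral_const_mul]
    refine integral_mono (hint r hr) (hU.norm.const_mul _) fun y => ?_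
    calc radialKernel r (y - x) * U y ≤ radialKernel r (y - x) * ‖U y‖ :=
          mul_le_mul_of_nonneg_left (Real.le_norm_self _) (radialKernel_nonneg _ _)
      _ ≤ B / r ^ 2 * ‖U y‖ := mul_le_mul_of_nonneg_right (hB _ _) (norm_nonneg _)
  rw [le_div_iff₀ hm, ← hxU, mul_comm]
  exact le_of_tendsto hx hle

end Subharmonic

/-! ### Smooth truncations -/

section Truncation

/-- A smooth nondecreasing function `T` with values in `[0, 1]` that vanishes on `(-∞, M]`, together
with a primitive `G` that differs from the identity by at most a constant on `[M, ∞)`. -/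
structure IsTruncation (M : ℝ) (C L : NNReal) (G T T' : ℝ → ℝ) : Prop where
  primitive_zero : G 0 = 0
  zero : T 0 = 0
  hasDerivAt_primitive : ∀ t, HasDerivAt G (T t) t
  hasDerivAt : ∀ t, HasDerivAt T (T' t) t
  nonneg : ∀ t, 0 ≤ T t
  le_one : ∀ t, T t ≤ 1
  le_mul : ∀ t, T t ≤ C * max (t - M) 0
  deriv_nonneg : ∀ t, 0 ≤ T' t
  deriv_le : ∀ t, ‖T' t‖₊ ≤ C
  lipschitz_deriv : LipschitzWith L T'
  sub_le_primitive : ∀ t, t - M - 1 ≤ G t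

theorem IsTruncation.lipschitz {M : ℝ} {C L : NNReal} {G T T' : ℝ → ℝ}
    (h : IsTruncation M C L G T T') : LipschitzWith C T :=
  lipschitzWith_of_nnnorm_deriv_le (fun t => (h.hasDerivAt t).differentiableAt)
    fun t => by rw [(h.hasDerivAt t).deriv]; exact h.deriv_le t

theorem exists_lipschitzWith_of_hasCompactSupport_deriv {f : ℝ → ℝ} (hf : ContDiff ℝ ∞ f)
    (hc : HasCompactSupport (deriv f)) :
    ∃ C : NNReal, LipschitzWith C f ∧ ∀ t, ‖deriv f t‖₊ ≤ C := by
  obtain ⟨C, hC⟩ := (hf.continuous_deriv (by simp)).bounded_above_of_compact_support hc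
  have hb : ∀ t, ‖deriv f t‖₊ ≤ C.toNNReal := fun t => NNReal.le_toNNReal_of_coe_le (hC t)
  exact ⟨C.toNNReal, lipschitzWith_of_nnnorm_deriv_le (hf.differentiable (by simp)) hb, hb⟩

theorem exists_isTruncation {M : ℝ} (hM : 0 ≤ M) :
    ∃ C L G T T', IsTruncation M C L G T T' := by
  set S := Real.smoothTransition
  have hS : ContDiff ℝ ∞ S := Real.smoothTransition.contDiff
  have hSd : ∀ t, HasDerivAt S (deriv S t) t := fun t =>
    (hS.differentiable (by simp) t).hasDerivAt
  have hS' : ContDiff ℝ ∞ (deriv S) := (contDiff_infty_iff_deriv.1 hS).2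
  have hcs : HasCompactSupport (deriv S) := by
    refine HasCompactSupport.of_support_subset_isCompact (isCompact_Icc (a := (0 : ℝ)) (b := 1))
      fun t ht => ⟨?_, ?_⟩ <;> by_contra! h
    · refine ht ?_
      have : S =ᶠ[𝓝 t] fun _ => 0 := by
        filter_upwards [gt_mem_nhds h] with s hs using
          Real.smoothTransition.zero_of_nonpos (le_of_lt hs)
      rw [this.deriv_eq, deriv_const]
    · refine ht ?_
      have : S =ᶠ[𝓝 t] fun _ => 1 := by
        filter_upwards [lt_mem_nhds h] with s hs using
          Real.smoothTransition.one_of_one_le (le_of_lt hs)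
      rw [this.deriv_eq, deriv_const]
  obtain ⟨C, hC, hC'⟩ := exists_lipschitzWith_of_hasCompactSupport_deriv hS hcs
  obtain ⟨L, hL, -⟩ := exists_lipschitzWith_of_hasCompactSupport_deriv hS' hcs.deriv
  have hshift : ∀ t, HasDerivAt (fun t : ℝ => t - M) 1 t := fun t => (hasDerivAt_id t).sub_const M
  have hG : ∀ t, HasDerivAt (fun t => ∫ s in (0 : ℝ)..t, S s) (S t) t := fun t =>
    intervalIntegral.integral_hasDerivAt_right (hS.continuous.intervalIntegrable _ _)
      (hS.continuous.stronglyMeasurableAtFilter _ _) hS.continuous.continuousAt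
  have hneg : ∀ t ≤ 0, ∫ s in (0 : ℝ)..t, S s = 0 := fun t ht => by
    refine (intervalIntegral.integral_congr fun s hs => ?_).trans intervalIntegral.integral_zero
    rw [uIcc_of_ge ht] at hs
    exact Real.smoothTransition.zero_of_nonpos hs.2
  -- The transition from `0` to `1` takes place on `[M, M + 1]`. Hence `G` loses at most `1` against
  -- `t - M`, and `G 0 = 0` because `0 ≤ M`.
  refine ⟨C, L, fun t => ∫ s in (0 : ℝ)..(t - M), S s, fun t => S (t - M),
    fun t => deriv S (t - M), ?_⟩
  constructor
  · exact hneg _ (by linarith)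
  · exact Real.smoothTransition.zero_of_nonpos (by linarith)
  · intro t
    have := HasDerivAt.comp (h₂ := fun t => ∫ s in (0 : ℝ)..t, S s) t (hG (t - M)) (hshift t)
    simpa using! this
  · intro t
    have := HasDerivAt.comp (h₂ := S) t (hSd (t - M)) (hshift t)
    simpa using! this
  · exact fun t => Real.smoothTransition.nonneg _
  · exact fun t => Real.smoothTransition.le_one _
  · intro t
    rcases le_total (t - M) 0 with h | h
    · have : S (t - M) = 0 := Real.smoothTransition.zero_of_nonpos h
      simp only [this]; positivity
    · have h1 := hC.dist_le_mul (t - M) 0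
      have h0 : S 0 = 0 := Real.smoothTransition.zero
      rw [h0, Real.dist_0_eq_abs, Real.dist_0_eq_abs, abs_of_nonneg h] at h1
      rw [max_eq_left h]
      exact (le_abs_self _).trans h1
  · exact fun t => Real.smoothTransition.monotone.deriv_nonneg
  · exact fun t => hC' _
  · have := hL.comp (LipschitzWith.id.sub (LipschitzWith.const M))
    simpa using! this
  · intro t
    have hint : ∀ a b, IntervalIntegrable S volume a b := hS.continuous.intervalIntegrable
    rcases le_total (t - M) 1 with h | h
    · rcases le_total (t - M) 0 with h0 | h0
      · simp only [hneg _ h0]; linarith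
      · have := intervalIntegral.integral_nonneg (μ := volume) h0
          (f := S) fun s _ => Real.smoothTransition.nonneg s
        linarith
    · have h1 : ∫ s in (0 : ℝ)..(t - M), S s =
          (∫ s in (0 : ℝ)..1, S s) + ∫ s in (1 : ℝ)..(t - M), S s :=
        (intervalIntegral.integral_add_adjacent_intervals (hint _ _) (hint _ _)).symm
      have h2 : ∫ s in (1 : ℝ)..(t - M), S s = t - M - 1 := by
        rw [intervalIntegral.integral_congr (g := fun _ => (1 : ℝ))]
        · simp
        · intro s hs
          rw [uIcc_of_le h] at hs
          exact Real.smoothTransition.one_of_one_le hs.1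
      have h3 := intervalIntegral.integral_nonneg (μ := volume) zero_le_one
          (f := S) fun s _ => Real.smoothTransition.nonneg s
      simp only [h1, h2]
      linarith

end Truncation

/-! ### Operations on `H¹` and `H¹₀` -/

section SobolevSpace

variable {F : Type*} [NormedAddCommGroup F] [NormedSpace ℝ F] {Ω : Set Plane} {i : Fin 2}

theorem HasWeakPartial.mono {f g : Plane → F} {Ω' : Set Plane} (h : HasWeakPartial Ω' i f g)
    (hΩ : Ω ⊆ Ω') : HasWeakPartial Ω i f g :=
  of_integral_smul_eq (h.locInt.mono_set hΩ) (h.locInt_deriv.mono_set hΩ)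
    fun _ hψ => h.integral_smul_eq (hψ.mono hΩ)

theorem HasWeakPartial.add {f₁ g₁ f₂ g₂ : Plane → F} (h₁ : HasWeakPartial Ω i f₁ g₁)
    (h₂ : HasWeakPartial Ω i f₂ g₂) :
    HasWeakPartial Ω i (fun x => f₁ x + f₂ x) (fun x => g₁ x + g₂ x) :=
  of_integral_smul_eq (h₁.locInt.add h₂.locInt) (h₁.locInt_deriv.add h₂.locInt_deriv)
    fun ψ hψ => by
      simp only [smul_add]
      rw [integral_add ((hψ.fderiv_stdVec i).integrable_smul h₁.locInt)
        ((hψ.fderiv_stdVec i).integrable_smul h₂.locInt),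
        integral_add (hψ.integrable_smul h₁.locInt_deriv) (hψ.integrable_smul h₂.locInt_deriv),
        h₁.integral_smul_eq hψ, h₂.integral_smul_eq hψ, neg_add]

theorem HasWeakPartial.const_smul {f g : Plane → F} (h : HasWeakPartial Ω i f g) (c : ℝ) :
    HasWeakPartial Ω i (fun x => c • f x) (fun x => c • g x) :=
  of_integral_smul_eq (h.locInt.smul c) (h.locInt_deriv.smul c) fun ψ hψ => by
    simp only [smul_comm _ c]
    rw [integral_smul, integral_smul, h.integral_smul_eq hψ, smul_neg]

theorem MemH1.add {f₁ f₂ : Plane → F} (h₁ : MemH1 Ω f₁) (h₂ : MemH1 Ω f₂) :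
    MemH1 Ω (fun x => f₁ x + f₂ x) where
  memLp := h₁.memLp.add h₂.memLp
  weakDeriv i := by
    obtain ⟨g₁, hg₁, m₁⟩ := h₁.weakDeriv i
    obtain ⟨g₂, hg₂, m₂⟩ := h₂.weakDeriv i
    exact ⟨_, hg₁.add hg₂, m₁.add m₂⟩

theorem MemH1.const_smul {f : Plane → F} (h : MemH1 Ω f) (c : ℝ) :
    MemH1 Ω (fun x => c • f x) where
  memLp := h.memLp.const_smul c
  weakDeriv i := by
    obtain ⟨g, hg, m⟩ := h.weakDeriv i
    exact ⟨_, hg.const_smul c, m.const_smul c⟩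

/-- The product of an `H¹` function and a test function is in `H¹₀`. -/
theorem IsTestFunction.memH10_mul {χ f : Plane → ℝ} {g : Fin 2 → Plane → ℝ}
    (hχ : IsTestFunction Ω χ) (hΩ : IsOpen Ω) (hf : MemLp f 2 (volume.restrict Ω))
    (hg : ∀ i, MemLp (g i) 2 (volume.restrict Ω)) (h : ∀ i, HasWeakPartial Ω i f (g i)) :
    MemH10 Ω (fun x => χ x * f x) := by
  have m1 : MemLp (fun x => χ x * f x) 2 volume := hχ.memLp_smul hΩ hf
  have m2 : ∀ i, MemLp (fun x => fderiv ℝ χ x (stdVec i) * f x + χ x * g i x) 2 volume := fun i =>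
    ((hχ.fderiv_stdVec i).memLp_smul hΩ hf).add (hχ.memLp_smul hΩ (hg i))
  have hw := fun i => ((h i).cutoff hχ).mono (subset_univ Ω)
  refine ⟨⟨m1.restrict Ω, fun i => ⟨_, hw i, (m2 i).restrict Ω⟩⟩, fun δ hδ => ?_⟩
  obtain ⟨k, hk, hk0, hk1⟩ := exists_isTestFunction_tendsto (f := fun x => χ x * f x) hΩ
    hχ.compact hχ.support (fun x hx => by simp [image_eq_zero_of_notMem_tsupport hx]) m1 m2
    (fun i => (h i).cutoff hχ)
  have hδ' : 0 < ENNReal.ofReal δ := ENNReal.ofReal_pos.2 hδ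
  have ev1 := ENNReal.tendsto_nhds_zero.1 hk0 _ hδ'
  have ev2 := eventually_all.2 fun i => ENNReal.tendsto_nhds_zero.1 (hk1 i) _ hδ'
  obtain ⟨n, hn1, hn2⟩ := (ev1.and ev2).exists
  refine ⟨k n, hk n, ?_, fun i => ?_⟩
  · refine le_trans (le_of_eq ?_) ((eLpNorm_mono_measure _ (Measure.restrict_le_self (s := Ω))).trans hn1)
    exact eLpNorm_sub_comm (fun x => χ x * f x) (k n) 2 _
  · refine le_trans (le_of_eq ?_) ((eLpNorm_mono_measure _ (Measure.restrict_le_self (s := Ω))).trans (hn2 i))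
    refine Eq.trans ?_ (eLpNorm_sub_comm
      (fun x => fderiv ℝ χ x (stdVec i) * f x + χ x * g i x) _ 2 _)
    refine eLpNorm_congr_ae ?_
    filter_upwards [(hw i).ae_eq_weakPartial hΩ] with x hx
    simp [hx]

end SobolevSpace

/-! ### Variations of the first component -/

section Variation

/-- Comparing right difference quotients gives `d ≤ 2 * A`. An upper bound for `f` is enough, so the
part of the energy containing `∇v` needs only to be estimated, not differentiated. -/
theorem nonneg_of_hasDerivWithinAt_of_le {f : ℝ → ℝ} {d A B ε₀ : ℝ} (hε₀ : 0 < ε₀)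
    (hf : HasDerivWithinAt f d (Ici 0) 0) (hd : 0 ≤ d)
    (h : ∀ ε, 0 < ε → ε < ε₀ → f ε ≤ f 0 + 2 * ε * A + ε ^ 2 * B) : 0 ≤ A := by
  have h1 : Tendsto (fun ε => ε⁻¹ * (f ε - f 0)) (𝓝[>] 0) (𝓝 d) := by
    have := (hasDerivWithinAt_iff_tendsto_slope' self_notMem_Ioi).1 hf.Ioi_of_Ici
    simpa [slope_fun_def] using this
  have h2 : Tendsto (fun ε : ℝ => 2 * A + ε * B) (𝓝[>] 0) (𝓝 (2 * A)) := by
    have : Tendsto (fun ε : ℝ => 2 * A + ε * B) (𝓝 0) (𝓝 (2 * A + 0 * B)) :=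
      Continuous.tendsto (by fun_prop) 0
    simpa using this.mono_left nhdsWithin_le_nhds
  have h3 : d ≤ 2 * A := by
    refine le_of_tendsto_of_tendsto h1 h2 ?_
    filter_upwards [Ioo_mem_nhdsGT hε₀] with ε hε
    have := h ε hε.1 hε.2
    rw [inv_mul_le_iff₀ hε.1]
    linarith
  linarith

theorem gradSq_ae_eq {F : Type*} [NormedAddCommGroup F] [NormedSpace ℝ F] [CompleteSpace F]
    {Ω : Set Plane} (hΩ : IsOpen Ω) {f : Plane → F} {g : Fin 2 → Plane → F}
    (h : ∀ i, HasWeakPartial Ω i f (g i)) :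
    gradSq Ω f =ᵐ[volume.restrict Ω] fun x => ∑ i, ‖g i x‖ ^ 2 := by
  filter_upwards [ae_all_iff.2 fun i => (h i).ae_eq_weakPartial hΩ] with x hx
  simp [gradSq, hx]

theorem isOpen_unitDisk : IsOpen unitDisk := Metric.isOpen_ball

variable {N : ℕ} {lam₀ lam : Plane → ℝ} {v : Plane → EuclideanSpace ℝ (Fin N)}

/-- By the product rule `λ ∂ᵢv = ∂ᵢ(λv) - (∂ᵢλ) v`, and both terms are in `L²` because `|v| = 1`.
Integrability is needed to compare Bochner integrals by monotonicity. -/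
theorem IsCriticalPair.integrable_sq_mul_gradSq (h : IsCriticalPair lam₀ lam v) :
    Integrable (fun x => lam x ^ 2 * gradSq unitDisk v x) (volume.restrict unitDisk) := by
  choose g hg mg using h.memH1_lam.weakDeriv
  choose w hw mw using h.memH1_v.weakDeriv
  choose p hp mp using h.memH1_mul.weakDeriv
  have hv : MemLp v ⊤ (volume.restrict unitDisk) :=
    memLp_top_of_bound h.memH1_v.memLp.1 1 (h.norm_v.mono fun _ hx => hx.le)
  have hm : ∀ i, MemLp (fun x => lam x • w i x) 2 (volume.restrict unitDisk) := fun i => by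
    have hprod := HasWeakPartial.smul isOpen_unitDisk h.memH1_lam.memLp mg hg h.memH1_v.memLp
      (mw i) (hw i)
    have e := (hp i).ae_eq isOpen_unitDisk hprod
    have m1 : MemLp (fun x => g i x • v x) 2 (volume.restrict unitDisk) := hv.smul (mg i)
    refine ((mp i).sub m1).ae_eq ?_
    filter_upwards [e] with x hx
    simp [hx]
  have hi : Integrable (fun x => ∑ i, ‖lam x • w i x‖ ^ 2) (volume.restrict unitDisk) :=
    integrable_finsetSum _ fun i _ => (hm i).integrable_norm_pow (by simp)
  refine hi.congr ?_
  filter_upwards [gradSq_ae_eq isOpen_unitDisk hw] with x hx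
  rw [hx, Finset.mul_sum]
  simp [norm_smul, mul_pow]

/-- Bounded nonpositive admissible variations of the first component. -/
theorem IsCriticalPair.integral_nonneg_of_nonpos (h : IsCriticalPair lam₀ lam v)
    {g dφ : Fin 2 → Plane → ℝ} (hg : ∀ i, HasWeakPartial unitDisk i lam (g i))
    (mg : ∀ i, MemLp (g i) 2 (volume.restrict unitDisk))
    {φ : Plane → ℝ} (hφ : MemH10 unitDisk φ) (hdφ : ∀ i, HasWeakPartial unitDisk i φ (dφ i))
    (mdφ : ∀ i, MemLp (dφ i) 2 (volume.restrict unitDisk)) {B : ℝ}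
    (hB : ∀ᵐ x ∂(volume.restrict unitDisk), ‖φ x‖ ≤ B)
    (hφ0 : ∀ᵐ x ∂(volume.restrict unitDisk), φ x ≤ 0) {ε₀ : ℝ} (hε₀ : 0 < ε₀)
    (hlam₀ : ∀ᵐ x ∂(volume.restrict unitDisk), 0 ≤ lam₀ x)
    (hobs : ∀ ε, 0 < ε → ε < ε₀ →
      ∀ᵐ x ∂(volume.restrict unitDisk), lam₀ x ≤ lam x + ε * φ x) :
    0 ≤ ∫ x in unitDisk, ∑ i, g i x * dφ i x := by
  choose w hw mw using h.memH1_v.weakDeriv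
  have hv : MemLp v ⊤ (volume.restrict unitDisk) :=
    memLp_top_of_bound h.memH1_v.memLp.1 1 (h.norm_v.mono fun _ hx => hx.le)
  have hφt : MemLp φ ⊤ (volume.restrict unitDisk) := memLp_top_of_bound hφ.memH1.memLp.1 B hB
  -- Boundedness of `φ` puts `φ ∂ᵢv` in `L²`, so that the competitor `(λ + εφ) v` stays in `H¹`.
  have hφv : MemH1 unitDisk (fun x => φ x • v x) := by
    refine ⟨hv.smul hφ.memH1.memLp, fun i => ⟨_, HasWeakPartial.smul isOpen_unitDisk
      hφ.memH1.memLp mdφ hdφ h.memH1_v.memLp (mw i) (hw i), ?_⟩⟩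
    have m1 : MemLp (fun x => dφ i x • v x) 2 (volume.restrict unitDisk) := hv.smul (mdφ i)
    have m2 : MemLp (fun x => φ x • w i x) 2 (volume.restrict unitDisk) := (mw i).smul hφt
    exact m1.add m2
  obtain ⟨d, hd, hd0⟩ := h.var_lam φ hφ ⟨ε₀, hε₀, fun ε h0 h1 => ⟨hobs ε h0 h1, by
    have := h.memH1_mul.add (hφv.const_smul ε)
    simpa only [add_smul, mul_smul] using this⟩⟩
  refine nonneg_of_hasDerivWithinAt_of_le (B := ∫ x in unitDisk, ∑ i, dφ i x ^ 2) hε₀ hd hd0 ?_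
  intro ε h0 h1
  have ig : Integrable (fun x => ∑ i, g i x ^ 2) (volume.restrict unitDisk) :=
    integrable_finsetSum _ fun i _ => (mg i).integrable_sq
  have igd : Integrable (fun x => ∑ i, g i x * dφ i x) (volume.restrict unitDisk) :=
    integrable_finsetSum _ fun i _ => (mg i).integrable_mul (mdφ i)
  have idd : Integrable (fun x => ∑ i, dφ i x ^ 2) (volume.restrict unitDisk) :=
    integrable_finsetSum _ fun i _ => (mdφ i).integrable_sq
  have e1 : ∫ x in unitDisk, gradSq unitDisk (fun x => lam x + ε * φ x) x =
      (∫ x in unitDisk, gradSq unitDisk lam x) +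
        2 * ε * (∫ x in unitDisk, ∑ i, g i x * dφ i x) +
        ε ^ 2 * ∫ x in unitDisk, ∑ i, dφ i x ^ 2 := by
    have a1 := gradSq_ae_eq isOpen_unitDisk fun i => (hg i).add ((hdφ i).const_smul ε)
    have a2 : ∀ x, ∑ i, ‖g i x + ε • dφ i x‖ ^ 2 = (∑ i, g i x ^ 2) +
        2 * ε * (∑ i, g i x * dφ i x) + ε ^ 2 * ∑ i, dφ i x ^ 2 := fun x => by
      simp only [Real.norm_eq_abs, sq_abs, smul_eq_mul, Fin.sum_univ_two]
      ring
    simp only [smul_eq_mul] at a1 a2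
    have i2 : Integrable (fun x => 2 * ε * ∑ i, g i x * dφ i x) (volume.restrict unitDisk) :=
      igd.const_mul _
    have i3 : Integrable (fun x => ε ^ 2 * ∑ i, dφ i x ^ 2) (volume.restrict unitDisk) :=
      idd.const_mul _
    have i12 : Integrable (fun x => (∑ i, g i x ^ 2) + 2 * ε * ∑ i, g i x * dφ i x)
      (volume.restrict unitDisk) := ig.add i2
    rw [integral_congr_ae a1, integral_congr_ae (gradSq_ae_eq isOpen_unitDisk hg)]
    simp only [a2]
    rw [integral_add i12 i3, integral_add ig i2, integral_const_mul, integral_const_mul]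
    simp only [Real.norm_eq_abs, sq_abs]
  -- The competitor satisfies `0 ≤ λ + εφ ≤ λ`, so its square is at most `λ²`.
  have e2 : ∫ x in unitDisk, (lam x + ε * φ x) ^ 2 * gradSq unitDisk v x ≤
      ∫ x in unitDisk, lam x ^ 2 * gradSq unitDisk v x := by
    have hgs : ∀ x, 0 ≤ gradSq unitDisk v x := fun x =>
      Finset.sum_nonneg fun i _ => sq_nonneg _
    refine integral_mono_of_nonneg (Eventually.of_forall fun x =>
      mul_nonneg (sq_nonneg _) (hgs x)) h.integrable_sq_mul_gradSq ?_
    filter_upwards [hφ0, hlam₀, hobs ε h0 h1] with x x1 x2 x3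
    have : ε * φ x ≤ 0 := mul_nonpos_of_nonneg_of_nonpos h0.le x1
    refine mul_le_mul_of_nonneg_right (pow_le_pow_left₀ (x2.trans x3) (by linarith) 2) (hgs x)
  simp only [energy, zero_mul, add_zero]
  rw [e1]
  linarith

/-- Truncations of the first component of a critical pair are weakly subharmonic. -/
theorem IsCriticalPair.integral_laplacian_mul_nonneg (h : IsCriticalPair lam₀ lam v) {M : ℝ}
    (hM : ∀ᵐ x ∂(volume.restrict unitDisk), lam₀ x ≤ M)
    (hlam₀ : ∀ᵐ x ∂(volume.restrict unitDisk), 0 ≤ lam₀ x) {C L : NNReal} {G T T' : ℝ → ℝ}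
    (hT : IsTruncation M C L G T T') {η : Plane → ℝ} (hη : IsTestFunction unitDisk η)
    (hη0 : ∀ x, 0 ≤ η x) :
    0 ≤ ∫ x, (∑ i, fderiv ℝ (fun y => fderiv ℝ η y (stdVec i)) x (stdVec i)) * G (lam x) := by
  choose g hg mg using h.memH1_lam.weakDeriv
  have cT := fun i => HasWeakPartial.comp isOpen_unitDisk h.memH1_lam.memLp mg hg hT.zero
    hT.hasDerivAt hT.deriv_le hT.lipschitz_deriv i
  have cG := fun i => HasWeakPartial.comp isOpen_unitDisk h.memH1_lam.memLp mg hg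
    hT.primitive_zero hT.hasDerivAt_primitive (C := 1)
    (fun t => by
      rw [← NNReal.coe_le_coe, coe_nnnorm, Real.norm_of_nonneg (hT.nonneg t)]; exact hT.le_one t)
    hT.lipschitz i
  obtain ⟨B, hB⟩ := hη.exists_norm_le
  have hB0 : 0 ≤ B := (norm_nonneg _).trans (hB 0)
  have hη' : IsTestFunction unitDisk (fun x => -η x) :=
    ⟨hη.smooth.neg, hη.compact.neg, (tsupport_neg η).trans_subset hη.support⟩
  have hdη : ∀ x i, fderiv ℝ (fun x => -η x) x (stdVec i) = -fderiv ℝ η x (stdVec i) :=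
    fun x i => by rw [fderiv_fun_neg]; rfl
  have hφ := hη'.memH10_mul isOpen_unitDisk (cT 0).1 (fun i => (cT i).2.1) fun i => (cT i).2.2
  have hdφ := fun i => ((cT i).2.2.cutoff hη').mono (subset_univ unitDisk)
  have mdφ : ∀ i, MemLp (fun x => fderiv ℝ (fun x => -η x) x (stdVec i) * T (lam x) +
      -η x * (T' (lam x) * g i x)) 2 (volume.restrict unitDisk) := fun i =>
    ((((hη'.fderiv_stdVec i).memLp_smul isOpen_unitDisk (cT i).1)).add
      (hη'.memLp_smul isOpen_unitDisk (cT i).2.1)).restrict unitDisk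
  -- With `η ≤ B` and `T(λ) ≤ C (λ - M)₊`, the condition `ε B C ≤ 1` ensures that `λ` is lowered by
  -- at most `(λ - M)₊`, hence stays above `lam₀`. The added `1` keeps the inverse meaningful when
  -- `B * C = 0`.
  have hobs : ∀ ε, 0 < ε → ε < (B * C + 1)⁻¹ →
      ∀ᵐ x ∂(volume.restrict unitDisk), lam₀ x ≤ lam x + ε * (-η x * T (lam x)) := by
    intro ε h0 h1
    filter_upwards [hM, h.obstacle] with x x1 x2
    have hBη : η x ≤ B := (Real.le_norm_self _).trans (hB x)
    have hε : ε * (B * C) ≤ 1 := by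
      have : ε * (B * C + 1) ≤ 1 := by
        rw [← le_div_iff₀ (by positivity), one_div]; exact h1.le
      nlinarith
    have hmul : η x * T (lam x) ≤ B * (C * max (lam x - M) 0) :=
      mul_le_mul hBη (hT.le_mul _) (hT.nonneg _) hB0
    have hfin : ε * (η x * T (lam x)) ≤ max (lam x - M) 0 := by
      calc ε * (η x * T (lam x)) ≤ ε * (B * (C * max (lam x - M) 0)) := by gcongr
        _ = ε * (B * C) * max (lam x - M) 0 := by ring
        _ ≤ 1 * max (lam x - M) 0 := by gcongr
        _ = _ := one_mul _
    rcases le_total (lam x - M) 0 with h' | h'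
    · rw [max_eq_right h'] at hfin; linarith
    · rw [max_eq_left h'] at hfin; linarith
  have hvar := h.integral_nonneg_of_nonpos hg mg hφ hdφ mdφ (B := B)
    (Eventually.of_forall fun x => by
      rw [norm_mul, norm_neg, Real.norm_of_nonneg (hT.nonneg _)]
      exact (mul_le_mul (hB x) (hT.le_one _) (hT.nonneg _) hB0).trans_eq (mul_one B))
    (Eventually.of_forall fun x => by
      rw [neg_mul, neg_nonpos]; exact mul_nonneg (hη0 x) (hT.nonneg _))
    (inv_pos.2 (by positivity)) hlam₀ hobs
  have hterm : ∀ i, Integrable (fun x => fderiv ℝ η x (stdVec i) * (T (lam x) * g i x)) volume :=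
    fun i => (hη.fderiv_stdVec i).integrable_smul (cG i).2.2.locInt_deriv
  -- The discarded term is `-η T'(λ) |∇λ|²`, nonpositive because `T` is nondecreasing.
  have hle : ∫ x in unitDisk, ∑ i, g i x * (fderiv ℝ (fun x => -η x) x (stdVec i) * T (lam x) +
      -η x * (T' (lam x) * g i x)) ≤
      ∫ x in unitDisk, -∑ i, fderiv ℝ η x (stdVec i) * (T (lam x) * g i x) := by
    refine integral_mono (integrable_finsetSum _ fun i _ => (mg i).integrable_mul (mdφ i))
      (integrable_finsetSum _ fun i _ => hterm i).neg.restrict fun x => ?_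
    simp only [hdη, Fin.sum_univ_two]
    have := mul_nonneg (mul_nonneg (hη0 x) (hT.deriv_nonneg (lam x)))
      (add_nonneg (sq_nonneg (g 0 x)) (sq_nonneg (g 1 x)))
    linarith
  have hset : ∫ x in unitDisk, -∑ i, fderiv ℝ η x (stdVec i) * (T (lam x) * g i x) =
      ∫ x, -∑ i, fderiv ℝ η x (stdVec i) * (T (lam x) * g i x) :=
    setIntegral_eq_integral_of_forall_compl_eq_zero fun x hx => by
      simp [(hη.fderiv_stdVec _).eq_zero hx]
  -- The weak gradient of `G(λ)` is `T(λ) ∇λ`; it is tested with the partial derivatives of `η`,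
  -- themselves test functions.
  have hparts : ∫ x, (∑ i, fderiv ℝ (fun y => fderiv ℝ η y (stdVec i)) x (stdVec i)) * G (lam x) =
      ∫ x, -∑ i, fderiv ℝ η x (stdVec i) * (T (lam x) * g i x) := by
    simp only [Finset.sum_mul]
    rw [integral_finsetSum, integral_neg, integral_finsetSum _ fun i _ => hterm i,
      ← Finset.sum_neg_distrib]
    · exact Finset.sum_congr rfl fun i _ => (cG i).2.2.integral_smul_eq (hη.fderiv_stdVec i)
    · exact fun i _ =>
        ((hη.fderiv_stdVec i).fderiv_stdVec i).integrable_smul (cG i).2.2.locInt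
  rw [hparts, ← hset]
  exact hvar.trans hle

end Variation

/-! ### Local boundedness -/

theorem proposition2p1 {N : ℕ} (lam₀ lam : Plane → ℝ) (v : Plane → EuclideanSpace ℝ (Fin N))
    (hlam₀ : MemLp lam₀ ⊤ (volume.restrict unitDisk))
    (hpos : ∃ c : ℝ, 0 < c ∧ ∀ᵐ x ∂(volume.restrict unitDisk), c ≤ lam₀ x)
    (hcrit : IsCriticalPair lam₀ lam v) :
    ∀ K : Set Plane, IsCompact K → K ⊆ unitDisk → MemLp lam ⊤ (volume.restrict K) := by
  intro K hK hKΩ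
  obtain ⟨c, hc, hc'⟩ := hpos
  have hlam₀0 : ∀ᵐ x ∂(volume.restrict unitDisk), 0 ≤ lam₀ x := hc'.mono fun x hx => hc.le.trans hx
  set M : ℝ := (eLpNorm lam₀ ⊤ (volume.restrict unitDisk)).toReal
  have hM : ∀ᵐ x ∂(volume.restrict unitDisk), lam₀ x ≤ M := by
    have := ae_le_eLpNormEssSup (f := lam₀) (μ := volume.restrict unitDisk)
    filter_upwards [this] with x hx
    rw [← eLpNorm_exponent_top] at hx
    have := ENNReal.toReal_mono hlam₀.2.ne hx
    rw [toReal_enorm] at this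
    exact (Real.le_norm_self _).trans this
  obtain ⟨C, L, G, T, T', hT⟩ := exists_isTruncation (M := M) ENNReal.toReal_nonneg
  have hGL : LipschitzWith 1 G := lipschitzWith_of_nnnorm_deriv_le
    (fun t => (hT.hasDerivAt_primitive t).differentiableAt) fun t => by
      rw [(hT.hasDerivAt_primitive t).deriv, ← NNReal.coe_le_coe, coe_nnnorm,
        Real.norm_of_nonneg (hT.nonneg t)]
      exact hT.le_one t
  have hfin : IsFiniteMeasure (volume.restrict unitDisk) :=
    ⟨by rw [Measure.restrict_apply_univ]; exact measure_ball_lt_top⟩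
  have hGi : IntegrableOn (fun x => G (lam x)) unitDisk volume :=
    (hGL.comp_memLp hT.primitive_zero hcrit.memH1_lam.memLp).integrable (by norm_num)
  obtain ⟨D, hD⟩ := exists_ae_le_of_subharmonic isOpen_unitDisk hK hKΩ hGi
    fun η hη hη0 => hcrit.integral_laplacian_mul_nonneg hM hlam₀0 hT hη hη0
  have hle : volume.restrict K ≤ volume.restrict unitDisk := Measure.restrict_mono hKΩ le_rfl
  -- The bound combines `G(λ) ≤ D` on `K` with `λ - M - 1 ≤ G(λ)`.
  refine memLp_top_of_bound (hcrit.memH1_lam.memLp.1.mono_measure hle) (D + M + 1) ?_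
  filter_upwards [hD, ae_mono hle hcrit.obstacle, ae_mono hle hlam₀0] with x x1 x2 x3
  rw [Real.norm_of_nonneg (x3.trans x2)]
  linarith [hT.sub_le_primitive (lam x)]
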